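/- For $\tau$ in the complex upper half-plane $\mathbb{H}$ and $r\in\mathbb{Q}$ put $q=e^{2\pi i\tau}$ and $q^{r}=e^{2\pi i r\tau}$, let $(a;q)_\infty=\prod_{n=0}^{\infty}(1-aq^n)$, and define $$I(\tau)=q^{3/4}\frac{(q;q^{10})_\infty(q^9;q^{10})_\infty}{(q^4;q^{10})_\infty(q^6;q^{10})_\infty},\qquad J(\tau)=q^{1/4}\frac{(q^2;q^{10})_\infty(q^8;q^{10})_\infty}{(q^3;q^{10})_\infty(q^7;q^{10})_\infty},\qquad U(\tau)=\frac{I(\tau)}{J(\tau)}.$$ A modular function on a congruence subgroup $\Gamma\subseteq \mathrm{SL}_2(\mathbb{Z})$ is a meromorphic function $f$ on $\mathbb{H}$ with $f(\gamma\tau)=f(\tau)$ for all $\gamma\in\Gamma$ that is meromorphic at all cusps: for every $\gamma\in\mathrm{SL}_2(\mathbb{Z})$ there are an integer $n_0$ and complex numbers $a_n$ with $f(\gamma\tau)=\sum_{n\ge n_0}a_nq^{n/h}$ for all $\tau$ of sufficiently large imaginary part, where $h$ is the width of the cusp $\gamma(\infty)$, that is, the smallest positive integer with $\gamma\begin{bmatrix}1&h\\0&1\end{bmatrix}\gamma^{-1}\in\pm\Gamma$.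 Let $\Gamma_0(10)$ be the group of all $\begin{bmatrix}a&b\\c&d\end{bmatrix}\in\mathrm{SL}_2(\mathbb{Z})$ with $c\equiv0\pmod{10}$. **Theorem.** The functions $I^4(\tau)+J^{-4}(\tau)$ and $J^4(\tau)+I^{-4}(\tau)$ are modular functions on $\Gamma_0(10)$, and for all $\tau\in\mathbb{H}$ $$I^4(\tau)+\frac{1}{J^4(\tau)}=\frac{1}{U^2(\tau)}-2+3U^2(\tau),$$ $$J^4(\tau)+\frac{1}{I^4(\tau)}=\frac{1}{U^6(\tau)}-\frac{2}{U^4(\tau)}+\frac{3}{U^2(\tau)}.$$ -/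

import Mathlib

open UpperHalfPlane
open scoped MatrixGroups

/-- The power `q ^ r = exp (2 π i r τ)` for a rational exponent `r`, where `q = exp (2 π i τ)`. -/
noncomputable def qPow (r : ℚ) (τ : ℍ) : ℂ :=
  Complex.exp (2 * Real.pi * Complex.I * r * τ)

/-- The infinite product `(a; q)_∞ = ∏_{n ≥ 0} (1 - a q ^ n)`. -/
noncomputable def qPochhammer (a q : ℂ) : ℂ :=
  ∏' n : ℕ, (1 - a * q ^ n)

/-- `I(τ) = q^(3/4) (q; q^10)_∞ (q^9; q^10)_∞ / ((q^4; q^10)_∞ (q^6; q^10)_∞)`. -/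
noncomputable def fracI (τ : ℍ) : ℂ :=
  qPow (3 / 4) τ *
    ((qPochhammer (qPow 1 τ) (qPow 10 τ) * qPochhammer (qPow 9 τ) (qPow 10 τ)) /
      (qPochhammer (qPow 4 τ) (qPow 10 τ) * qPochhammer (qPow 6 τ) (qPow 10 τ)))

/-- `J(τ) = q^(1/4) (q^2; q^10)_∞ (q^8; q^10)_∞ / ((q^3; q^10)_∞ (q^7; q^10)_∞)`. -/
noncomputable def fracJ (τ : ℍ) : ℂ :=
  qPow (1 / 4) τ *
    ((qPochhammer (qPow 2 τ) (qPow 10 τ) * qPochhammer (qPow 8 τ) (qPow 10 τ)) /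
      (qPochhammer (qPow 3 τ) (qPow 10 τ) * qPochhammer (qPow 7 τ) (qPow 10 τ)))

/-- `U(τ) = I(τ) / J(τ)`. -/
noncomputable def fracU (τ : ℍ) : ℂ :=
  fracI τ / fracJ τ

/-- `h` is the width of the cusp `γ ∞` of `Γ`: the smallest positive integer such that
`γ T ^ h γ⁻¹ ∈ ± Γ`, where `T` is the translation by one. -/
def IsCuspWidth (Γ : Subgroup SL(2, ℤ)) (γ : SL(2, ℤ)) (h : ℕ) : Prop :=
  IsLeast {m : ℕ | 0 < m ∧
    (γ * ModularGroup.T ^ m * γ⁻¹ ∈ Γ ∨ -(γ * ModularGroup.T ^ m * γ⁻¹) ∈ Γ)} h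

/-- Modular functions on a subgroup `Γ` of finite index in `SL(2, ℤ)`: meromorphic functions on
the upper half-plane that are invariant under `Γ` and meromorphic at all cusps. As `γ` runs over
`SL(2, ℤ)`, the point `γ ∞` runs over all of `ℚ ∪ {∞}`.

A meromorphic function is represented here by a function `ℍ → ℂ` without removable
singularities that takes the value `0` at its poles. -/
structure IsModularFunction (Γ : Subgroup SL(2, ℤ)) (f : ℍ → ℂ) : Prop where
  meromorphic : MeromorphicNFOn (f ∘ UpperHalfPlane.ofComplex) {z : ℂ | 0 < z.im}
  invariant : ∀ γ ∈ Γ, ∀ τ : ℍ, f (γ • τ) = f τ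
  /-- Near `i ∞`, the function `f ∘ γ` has an expansion `∑_{n ≥ n₀} a n * q ^ (n / h)`. -/
  meromorphic_at_cusps : ∀ γ : SL(2, ℤ), ∃ h : ℕ, IsCuspWidth Γ γ h ∧
    ∃ (n₀ : ℤ) (a : ℤ → ℂ) (B : ℝ), ∀ τ : ℍ, B < τ.im →
      HasSum (fun k : ℕ ↦ a (n₀ + k) * qPow (((n₀ + k : ℤ) : ℚ) / (h : ℚ)) τ) (f (γ • τ))

/-! The products above converge and do not vanish, so no division by zero occurs. -/

theorem norm_qPow_lt_one {r : ℚ} (hr : 0 < r) (τ : ℍ) : ‖qPow r τ‖ < 1 := by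
  have h1 : (0 : ℝ) < r := by exact_mod_cast hr
  have h2 : (2 * Real.pi * Complex.I * r * (τ : ℂ)).re = -(2 * Real.pi * r * τ.im) := by
    have : (2 * Real.pi * Complex.I * r * (τ : ℂ)) =
        ((2 * Real.pi * r : ℝ) : ℂ) * (Complex.I * τ) := by push_cast; ring
    rw [this, Complex.re_ofReal_mul]
    simp
  rw [qPow, Complex.norm_exp, h2, Real.exp_lt_one_iff, neg_lt_zero]
  have := τ.im_pos
  positivity

theorem summable_qPochhammer (a : ℂ) {q : ℂ} (hq : ‖q‖ < 1) :
    Summable fun n : ℕ ↦ ‖-(a * q ^ n)‖ := by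
  simpa using (summable_geometric_of_lt_one (norm_nonneg _) hq).mul_left ‖a‖

theorem multipliable_qPochhammer (a : ℂ) {q : ℂ} (hq : ‖q‖ < 1) :
    Multipliable fun n : ℕ ↦ 1 - a * q ^ n := by
  simpa [sub_eq_add_neg] using multipliable_one_add_of_summable (summable_qPochhammer a hq)

theorem qPochhammer_ne_zero {a q : ℂ} (ha : ‖a‖ < 1) (hq : ‖q‖ < 1) : qPochhammer a q ≠ 0 := by
  have h : ∏' n : ℕ, (1 + -(a * q ^ n)) ≠ 0 := by
    refine tprod_one_add_ne_zero_of_summable (fun n h0 ↦ ?_) (summable_qPochhammer a hq)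
    have h1 : a * q ^ n = 1 := by linear_combination -h0
    have h2 : ‖a * q ^ n‖ < 1 := by
      rw [norm_mul, norm_pow]
      exact (mul_le_of_le_one_right (norm_nonneg _)
        (pow_le_one₀ (norm_nonneg _) hq.le)).trans_lt ha
    rw [h1, norm_one] at h2
    exact lt_irrefl _ h2
  simpa [qPochhammer, sub_eq_add_neg] using h

theorem fracI_ne_zero (τ : ℍ) : fracI τ ≠ 0 := by
  have hp : ∀ r : ℚ, 0 < r → qPochhammer (qPow r τ) (qPow 10 τ) ≠ 0 := fun r hr ↦
    qPochhammer_ne_zero (norm_qPow_lt_one hr τ) (norm_qPow_lt_one (by norm_num) τ)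
  exact mul_ne_zero (Complex.exp_ne_zero _) (div_ne_zero
    (mul_ne_zero (hp 1 (by norm_num)) (hp 9 (by norm_num)))
    (mul_ne_zero (hp 4 (by norm_num)) (hp 6 (by norm_num))))

theorem fracJ_ne_zero (τ : ℍ) : fracJ τ ≠ 0 := by
  have hp : ∀ r : ℚ, 0 < r → qPochhammer (qPow r τ) (qPow 10 τ) ≠ 0 := fun r hr ↦
    qPochhammer_ne_zero (norm_qPow_lt_one hr τ) (norm_qPow_lt_one (by norm_num) τ)
  exact mul_ne_zero (Complex.exp_ne_zero _) (div_ne_zero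
    (mul_ne_zero (hp 2 (by norm_num)) (hp 8 (by norm_num)))
    (mul_ne_zero (hp 3 (by norm_num)) (hp 7 (by norm_num))))

/-! Both identities follow from the single relation `1/(IJ) - IJ = 1/U² - 1`
(`inv_sub_fracI_mul_fracJ`): squaring it and multiplying by `U²` gives the first, because `U²/(IJ)²
= J⁻⁴` and `U²(IJ)² = I⁴`; dividing the first by `U⁴` gives the second. With `P_a = (q^a, q^(10-a);
q^10)_∞`, the relation comes from two instances of Weierstrass' three-term theta relation, between
which `P_5` is eliminated. The Jacobi triple product turns theta values into the products `P_a`.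

Both functions are thus Laurent polynomials in `U²`, so modularity reduces to `U`. Product
expansions give `U(τ) = θ₂(5τ)/θ₂(τ)`. Since `θ₂²` has weight one on `Γ₀(2)` with an explicit
character (`thetaTwo_sq_moebius`), weights and characters cancel and `U²` is invariant under
`Γ₀(10)`. As `θ₂` has no zeros on the upper half-plane, `U` is holomorphic and nonvanishing there.

At the cusps, `SL(2, ℤ)` permutes the three functions `|θ_j|⁴ im τ`. Hence `U` and `1/U` grow at
most exponentially along every translate (`fracU_growth`). For an invariant holomorphic function
this already yields a `q`-expansion with finitely many negative exponents
(`isModularFunction_of_growth`). -/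

/-! ### The Jacobi triple product -/

/-- The finite product `(q; q)_n`. -/
noncomputable def qFact (q : ℂ) (n : ℕ) : ℂ := ∏ i ∈ Finset.range n, (1 - q * q ^ i)

/-- The Gaussian binomial coefficient, extended by zero. -/
noncomputable def qChoose (q : ℂ) (N k : ℕ) : ℂ :=
  if k ≤ N then qFact q N / (qFact q k * qFact q (N - k)) else 0

theorem qFact_succ (q : ℂ) (n : ℕ) : qFact q (n + 1) = qFact q n * (1 - q ^ (n + 1)) := by
  rw [qFact, Finset.prod_range_succ, pow_succ', qFact]

theorem one_sub_pow_succ_ne_zero {q : ℂ} (hq : ‖q‖ < 1) (n : ℕ) : 1 - q ^ (n + 1) ≠ 0 := by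
  intro h
  have h1 : ‖q ^ (n + 1)‖ = 1 := by rw [← sub_eq_zero.mp h, norm_one]
  rw [norm_pow] at h1
  exact absurd h1 (pow_lt_one₀ (norm_nonneg _) hq (by lia)).ne

theorem qFact_ne_zero {q : ℂ} (hq : ‖q‖ < 1) (n : ℕ) : qFact q n ≠ 0 := by
  induction n with
  | zero => simp [qFact]
  | succ n ih => rw [qFact_succ]; exact mul_ne_zero ih (one_sub_pow_succ_ne_zero hq n)

theorem qChoose_zero_right {q : ℂ} (hq : ‖q‖ < 1) (N : ℕ) : qChoose q N 0 = 1 := by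
  have := qFact_ne_zero hq N
  have h0 : qFact q 0 = 1 := by simp [qFact]
  simp [qChoose, h0, this]

theorem qChoose_self {q : ℂ} (hq : ‖q‖ < 1) (N : ℕ) : qChoose q N N = 1 := by
  have := qFact_ne_zero hq N
  have h0 : qFact q 0 = 1 := by simp [qFact]
  simp [qChoose, h0, this]

theorem qChoose_succ {q : ℂ} (hq : ‖q‖ < 1) {N k : ℕ} (hk : k ≤ N) :
    qChoose q (N + 1) (k + 1) = qChoose q N (k + 1) + q ^ (N - k) * qChoose q N k := by
  rcases hk.eq_or_lt with rfl | hlt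
  · rw [qChoose_self hq, qChoose_self hq, qChoose, if_neg (by lia)]
    simp
  · obtain ⟨m, rfl⟩ : ∃ m, N = k + 1 + m := ⟨N - k - 1, by lia⟩
    rw [qChoose, qChoose, qChoose, if_pos (by lia), if_pos (by lia), if_pos (by lia)]
    have e1 : k + 1 + m + 1 - (k + 1) = m + 1 := by lia
    have e2 : k + 1 + m - (k + 1) = m := by lia
    have e3 : k + 1 + m - k = m + 1 := by lia
    rw [e1, e2, e3, qFact_succ q (k + 1 + m), qFact_succ q m, qFact_succ q k]
    have := qFact_ne_zero hq k
    have := qFact_ne_zero hq m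
    have := one_sub_pow_succ_ne_zero hq k
    have := one_sub_pow_succ_ne_zero hq m
    field_simp
    ring

theorem choose_two_succ (k : ℕ) : (k + 1).choose 2 = k + k.choose 2 := by
  rw [Nat.choose_succ_succ' k 1, Nat.choose_one_right]

/-- Induction on `N`: writing `q^N = q^(N-k) q^k`, multiplication by the new factor `1 + y q^N` is
exactly the `q`-Pascal rule `qChoose_succ`. -/
theorem qBinomial {q : ℂ} (hq : ‖q‖ < 1) (y : ℂ) (N : ℕ) :
    ∏ k ∈ Finset.range N, (1 + y * q ^ k) =
      ∑ k ∈ Finset.range (N + 1), q ^ k.choose 2 * qChoose q N k * y ^ k := by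
  induction N with
  | zero => simp [qChoose_self hq]
  | succ N ih =>
    rw [Finset.prod_range_succ, ih, Finset.sum_range_succ' _ (N + 1)]
    have h1 : ∑ k ∈ Finset.range (N + 1), q ^ k.choose 2 * qChoose q N k * y ^ k =
        ∑ k ∈ Finset.range (N + 1), q ^ (k + 1).choose 2 * qChoose q N (k + 1) * y ^ (k + 1)
          + 1 := by
      have h2 : qChoose q N (N + 1) = 0 := by rw [qChoose, if_neg (by lia)]
      have h3 := Finset.sum_range_succ (fun k ↦ q ^ k.choose 2 * qChoose q N k * y ^ k) (N + 1)
      rw [h2, Finset.sum_range_succ'] at h3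
      simpa [qChoose_zero_right hq] using h3.symm
    rw [mul_add, mul_one]
    nth_rewrite 1 [h1]
    rw [qChoose_zero_right hq, Finset.sum_mul, add_right_comm, ← Finset.sum_add_distrib]
    congr 1
    · refine Finset.sum_congr rfl fun k hk ↦ ?_
      have hk' : k ≤ N := by have := Finset.mem_range.mp hk; lia
      have e : q ^ N = q ^ (N - k) * q ^ k := by rw [← pow_add]; congr 1; lia
      rw [qChoose_succ hq hk', choose_two_succ, e, pow_add, pow_succ y]
      ring
    · simp

/-- The parameter `exp (2 π i τ)`. -/
noncomputable def qExp (τ : ℂ) : ℂ := Complex.exp (2 * Real.pi * Complex.I * τ)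

theorem qExp_ne_zero (τ : ℂ) : qExp τ ≠ 0 := Complex.exp_ne_zero _

theorem qExp_add (a b : ℂ) : qExp (a + b) = qExp a * qExp b := by
  rw [qExp, qExp, qExp, ← Complex.exp_add]; ring_nf

theorem qExp_neg (a : ℂ) : qExp (-a) = (qExp a)⁻¹ := by
  rw [qExp, qExp, ← Complex.exp_neg]; ring_nf

theorem qExp_sub (a b : ℂ) : qExp (a - b) = qExp a / qExp b := by
  rw [sub_eq_add_neg, qExp_add, qExp_neg, div_eq_mul_inv]

theorem qExp_nat_mul (n : ℕ) (a : ℂ) : qExp (n * a) = qExp a ^ n := by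
  rw [qExp, qExp, ← Complex.exp_nat_mul]; ring_nf

theorem qExp_half : qExp (1 / 2) = -1 := by
  rw [qExp, ← Complex.exp_pi_mul_I]; ring_nf

theorem norm_qExp (τ : ℂ) : ‖qExp τ‖ = Real.exp (-(2 * Real.pi * τ.im)) := by
  rw [qExp, Complex.norm_exp]
  congr 1
  simp

theorem norm_qExp_lt_one {τ : ℂ} (hτ : 0 < τ.im) : ‖qExp τ‖ < 1 := by
  rw [norm_qExp, Real.exp_lt_one_iff]
  have := Real.pi_pos
  rw [neg_lt_zero]; positivity

/-- Completing the square: the binomial exponents of `q` combine to `(k - n)²/2`. -/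
theorem jacobiTheta₂_term_sub (k n : ℕ) (z τ : ℂ) :
    qExp τ ^ k.choose 2 * (qExp (z + τ / 2) * (qExp τ ^ n)⁻¹) ^ k * (qExp (z + τ / 2) ^ n)⁻¹ *
      qExp τ ^ (n + 1).choose 2 = jacobiTheta₂_term (k - n) z τ := by
  rw [← qExp_nat_mul, ← qExp_nat_mul, ← qExp_neg, ← qExp_add, ← qExp_nat_mul, ← qExp_nat_mul,
    ← qExp_neg, ← qExp_add, ← qExp_nat_mul, ← qExp_add, ← qExp_add, qExp, jacobiTheta₂_term,
    Nat.cast_choose_two, Nat.cast_choose_two]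
  congr 1
  push_cast
  ring

/-- The finite triple product: the `q`-binomial theorem with `2n` factors at `y = x q^(-n)`. The
first `n` factors have negative powers of `q`; pulling out `x q^(-j)` turns them into factors in
`q/x`. -/
theorem prod_tripleProduct {z τ : ℂ} (hτ : 0 < τ.im) (n : ℕ) :
    (∏ k ∈ Finset.range n, (1 + qExp (z + τ / 2) * qExp τ ^ k)) *
      (∏ k ∈ Finset.range n, (1 + qExp τ / qExp (z + τ / 2) * qExp τ ^ k)) =
    ∑ k ∈ Finset.range (2 * n + 1),
      qChoose (qExp τ) (2 * n) k * jacobiTheta₂_term (k - n) z τ := by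
  have hq := norm_qExp_lt_one hτ
  have h := qBinomial hq (qExp (z + τ / 2) * (qExp τ ^ n)⁻¹) (2 * n)
  set q := qExp τ
  set x := qExp (z + τ / 2)
  have hx : x ≠ 0 := qExp_ne_zero _
  have hq0 : q ≠ 0 := qExp_ne_zero _
  have h1 : ∀ n : ℕ, ∏ k ∈ Finset.range n, (1 + x * (q ^ n)⁻¹ * q ^ k) =
      (∏ k ∈ Finset.range n, (1 + q / x * q ^ k)) * (x ^ n * (q ^ (n + 1).choose 2)⁻¹) := by
    intro n
    rw [← Finset.prod_range_reflect]
    have h2 : x ^ n * (q ^ (n + 1).choose 2)⁻¹ =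
        ∏ k ∈ Finset.range n, x * (q ^ (k + 1))⁻¹ := by
      induction n with
      | zero => simp
      | succ n ih =>
        rw [Finset.prod_range_succ, ← ih, choose_two_succ (n + 1), pow_add q (n + 1), pow_succ x]
        field_simp
    rw [h2, ← Finset.prod_mul_distrib]
    refine Finset.prod_congr rfl fun k hk ↦ ?_
    have hk' := Finset.mem_range.mp hk
    have e : q ^ n = q ^ (n - 1 - k) * q ^ (k + 1) := by rw [← pow_add]; congr 1; lia
    rw [e]
    have := pow_ne_zero (n - 1 - k) hq0
    field_simp
    ring
  rw [two_mul n, Finset.prod_range_add, h1] at h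
  have h3 : ∏ k ∈ Finset.range n, (1 + x * (q ^ n)⁻¹ * q ^ (n + k)) =
      ∏ k ∈ Finset.range n, (1 + x * q ^ k) := by
    refine Finset.prod_congr rfl fun k _ ↦ ?_
    rw [pow_add]
    have := pow_ne_zero n hq0
    field_simp
  rw [h3, ← two_mul n] at h
  have h4 : ∀ k, qChoose q (2 * n) k * jacobiTheta₂_term (k - n) z τ =
      q ^ k.choose 2 * qChoose q (2 * n) k * (x * (q ^ n)⁻¹) ^ k *
        ((x ^ n)⁻¹ * q ^ (n + 1).choose 2) := fun k ↦ by
    rw [← jacobiTheta₂_term_sub]; ring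
  rw [Finset.sum_congr rfl fun k _ ↦ h4 k, ← Finset.sum_mul, ← h]
  have := pow_ne_zero n hx
  have := pow_ne_zero ((n + 1).choose 2) hq0
  field_simp

theorem tendsto_qPochhammer (a : ℂ) {q : ℂ} (hq : ‖q‖ < 1) :
    Filter.Tendsto (fun n ↦ ∏ k ∈ Finset.range n, (1 - a * q ^ k)) Filter.atTop
      (nhds (qPochhammer a q)) :=
  (multipliable_qPochhammer a hq).hasProd.tendsto_prod_nat

/-- `(q; q)_n` has a nonzero limit, so it and its inverse are bounded. This supplies the dominating
bound for the limit of the finite triple product. -/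
theorem exists_norm_qChoose_le {q : ℂ} (hq : ‖q‖ < 1) :
    ∃ C : ℝ, ∀ N k : ℕ, ‖qChoose q N k‖ ≤ C := by
  have h1 : Filter.Tendsto (fun n ↦ ‖qFact q n‖) Filter.atTop (nhds ‖qPochhammer q q‖) :=
    (tendsto_qPochhammer q hq).norm
  have h2 := h1.inv₀ (norm_ne_zero_iff.mpr (qPochhammer_ne_zero hq hq))
  obtain ⟨A, hA⟩ := h1.bddAbove_range
  obtain ⟨B, hB⟩ := h2.bddAbove_range
  have hA' : ∀ n, ‖qFact q n‖ ≤ A := fun n ↦ hA ⟨n, rfl⟩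
  have hB' : ∀ n, ‖qFact q n‖⁻¹ ≤ B := fun n ↦ hB ⟨n, rfl⟩
  have hA0 : 0 ≤ A := (norm_nonneg _).trans (hA' 0)
  have hB0 : 0 ≤ B := (inv_nonneg.mpr (norm_nonneg _)).trans (hB' 0)
  refine ⟨A * (B * B), fun N k ↦ ?_⟩
  rw [qChoose]
  split_ifs with h
  · rw [norm_div, norm_mul, div_eq_mul_inv, mul_inv]
    have := hA' N
    have := hB' k
    have := hB' (N - k)
    gcongr
  · simp only [norm_zero]; positivity

/-- The **Jacobi triple product**. -/
theorem jacobiTheta₂_eq_qPochhammer (z : ℂ) {τ : ℂ} (hτ : 0 < τ.im) :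
    jacobiTheta₂ z τ = qPochhammer (-qExp (z + τ / 2)) (qExp τ) *
      qPochhammer (-(qExp τ / qExp (z + τ / 2))) (qExp τ) * qPochhammer (qExp τ) (qExp τ) := by
  have hq := norm_qExp_lt_one hτ
  have hfin := fun n ↦ prod_tripleProduct (z := z) hτ n
  have hL := (tendsto_qPochhammer (-qExp (z + τ / 2)) hq).mul
    (tendsto_qPochhammer (-(qExp τ / qExp (z + τ / 2))) hq)
  simp only [neg_mul, sub_neg_eq_add, hfin] at hL
  set q := qExp τ
  -- Recentring the coefficients and extending them by zero makes every finite sum a sum over all of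
  -- `ℤ`. Each coefficient tends to `1/(q; q)_∞`, so dominated convergence applies.
  let c : ℕ → ℤ → ℂ := fun n j ↦
    if j ∈ Finset.Icc (-n : ℤ) n then qChoose q (2 * n) (j + n).toNat else 0
  have hsum : ∀ n : ℕ, ∑ k ∈ Finset.range (2 * n + 1),
      qChoose q (2 * n) k * jacobiTheta₂_term (k - n) z τ =
      ∑' j : ℤ, c n j * jacobiTheta₂_term j z τ := by
    intro n
    rw [tsum_eq_sum (s := Finset.Icc (-n : ℤ) n) (fun j hj ↦ by simp only [c, if_neg hj, zero_mul])]
    refine Finset.sum_bij (fun k _ ↦ (k : ℤ) - n) ?_ ?_ ?_ ?_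
    · intro k hk
      rw [Finset.mem_range] at hk
      rw [Finset.mem_Icc]; lia
    · intro a _ b _ h
      lia
    · intro j hj
      rw [Finset.mem_Icc] at hj
      exact ⟨(j + n).toNat, by rw [Finset.mem_range]; lia, by lia⟩
    · intro k hk
      rw [Finset.mem_range] at hk
      have h1 : (k : ℤ) - n ∈ Finset.Icc (-n : ℤ) n := by rw [Finset.mem_Icc]; lia
      simp only [c, if_pos h1, sub_add_cancel, Int.toNat_natCast]
  simp only [hsum] at hL
  obtain ⟨C, hC⟩ := exists_norm_qChoose_le hq
  have hC0 : 0 ≤ C := (norm_nonneg _).trans (hC 0 0)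
  have hne := qPochhammer_ne_zero hq hq
  have hfact : Filter.Tendsto (qFact q) Filter.atTop (nhds (qPochhammer q q)) :=
    tendsto_qPochhammer q hq
  have hR : Filter.Tendsto (fun n ↦ ∑' j : ℤ, c n j * jacobiTheta₂_term j z τ) Filter.atTop
      (nhds (∑' j : ℤ, (qPochhammer q q)⁻¹ * jacobiTheta₂_term j z τ)) := by
    refine tendsto_tsum_of_dominated_convergence
      (bound := fun j ↦ C * ‖jacobiTheta₂_term j z τ‖) ?_ ?_ ?_
    · exact ((summable_jacobiTheta₂_term_iff z τ).mpr hτ).norm.mul_left C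
    · intro j
      refine Filter.Tendsto.mul_const _ ?_
      have hlim : Filter.Tendsto (fun n : ℕ ↦ qFact q (2 * n) /
          (qFact q (j + n).toNat * qFact q (2 * n - (j + n).toNat))) Filter.atTop
          (nhds (qPochhammer q q / (qPochhammer q q * qPochhammer q q))) := by
        refine (hfact.comp ?_).div ((hfact.comp ?_).mul (hfact.comp ?_)) (mul_ne_zero hne hne)
        · exact Filter.tendsto_atTop_atTop.mpr fun b ↦ ⟨b, fun a h ↦ by lia⟩
        · exact Filter.tendsto_atTop_atTop.mpr fun b ↦ ⟨b + j.natAbs, fun a h ↦ by lia⟩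
        · exact Filter.tendsto_atTop_atTop.mpr fun b ↦ ⟨b + j.natAbs, fun a h ↦ by lia⟩
      rw [div_mul_cancel_left₀ hne] at hlim
      refine hlim.congr' ?_
      filter_upwards [Filter.eventually_ge_atTop j.natAbs] with n hn
      have h1 : j ∈ Finset.Icc (-n : ℤ) n := by rw [Finset.mem_Icc]; lia
      simp only [c, if_pos h1, qChoose]
      rw [if_pos (by lia)]
    · filter_upwards with n j
      rw [norm_mul]
      gcongr
      simp only [c]
      split_ifs
      · exact hC _ _
      · simpa using hC0
  have := tendsto_nhds_unique hL hR
  rw [this, tsum_mul_left, mul_comm, ← mul_assoc, mul_inv_cancel₀ hne, one_mul, jacobiTheta₂]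

/-! ### Addition formulas for theta functions -/

/-- The parallelogram law `(a+b)² + (a-b)² = 2a² + 2b²`; the next lemma is the odd case `(a+b+1)² +
(a-b)² = 2(a+1/2)² + 2(b+1/2)²`. -/
theorem jacobiTheta₂_mul_aux (a b : ℤ) (u v τ : ℂ) :
    jacobiTheta₂_term (a + b) (u + v) τ * jacobiTheta₂_term (a - b) (u - v) τ =
      jacobiTheta₂_term a (2 * u) (2 * τ) * jacobiTheta₂_term b (2 * v) (2 * τ) := by
  simp only [jacobiTheta₂_term]
  rw [← Complex.exp_add, ← Complex.exp_add]
  congr 1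
  push_cast
  ring

theorem jacobiTheta₂_mul_aux' (a b : ℤ) (u v τ : ℂ) :
    jacobiTheta₂_term (a + b + 1) (u + v) τ * jacobiTheta₂_term (a - b) (u - v) τ =
      (Complex.exp (Real.pi * Complex.I * (τ / 2 + 2 * u)) *
        jacobiTheta₂_term a (2 * u + τ) (2 * τ)) *
      (Complex.exp (Real.pi * Complex.I * (τ / 2 + 2 * v)) *
        jacobiTheta₂_term b (2 * v + τ) (2 * τ)) := by
  simp only [jacobiTheta₂_term]
  rw [← Complex.exp_add, ← Complex.exp_add, ← Complex.exp_add, ← Complex.exp_add]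
  congr 1
  push_cast
  ring

/-- The coefficient function `θ₂(2 u | 2 τ)`, up to normalization. -/
noncomputable def thetaShift (u τ : ℂ) : ℂ :=
  Complex.exp (Real.pi * Complex.I * (τ / 2 + 2 * u)) * jacobiTheta₂ (2 * u + τ) (2 * τ)

theorem hasSum_mul_prod {f g : ℤ → ℂ} {s t : ℂ} (hf : HasSum f s) (hg : HasSum g t) :
    HasSum (fun p : ℤ × ℤ ↦ f p.1 * g p.2) (s * t) :=
  hf.mul hg (summable_mul_of_summable_norm hf.summable.norm hg.summable.norm)

/-- The double series over `(m, n)` is split by the parity of `m + n`; `e₀` and `e₁` parametrize the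
even and odd pairs. -/
theorem jacobiTheta₂_add_mul_sub (u v : ℂ) {τ : ℂ} (hτ : 0 < τ.im) :
    jacobiTheta₂ (u + v) τ * jacobiTheta₂ (u - v) τ =
      jacobiTheta₂ (2 * u) (2 * τ) * jacobiTheta₂ (2 * v) (2 * τ) +
        thetaShift u τ * thetaShift v τ := by
  have h2τ : 0 < (2 * τ).im := by simpa using hτ
  have hL := hasSum_mul_prod (hasSum_jacobiTheta₂_term (u + v) hτ)
    (hasSum_jacobiTheta₂_term (u - v) hτ)
  have hA := hasSum_mul_prod (hasSum_jacobiTheta₂_term (2 * u) h2τ)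
    (hasSum_jacobiTheta₂_term (2 * v) h2τ)
  have hB := hasSum_mul_prod ((hasSum_jacobiTheta₂_term (2 * u + τ) h2τ).mul_left
      (Complex.exp (Real.pi * Complex.I * (τ / 2 + 2 * u))))
    ((hasSum_jacobiTheta₂_term (2 * v + τ) h2τ).mul_left
      (Complex.exp (Real.pi * Complex.I * (τ / 2 + 2 * v))))
  let e₀ : ℤ × ℤ → ℤ × ℤ := fun p ↦ (p.1 + p.2, p.1 - p.2)
  let e₁ : ℤ × ℤ → ℤ × ℤ := fun p ↦ (p.1 + p.2 + 1, p.1 - p.2)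
  have i₀ : Function.Injective e₀ := by
    rintro ⟨a, b⟩ ⟨c, d⟩ h
    simp only [e₀, Prod.mk.injEq] at h ⊢
    lia
  have i₁ : Function.Injective e₁ := by
    rintro ⟨a, b⟩ ⟨c, d⟩ h
    simp only [e₁, Prod.mk.injEq] at h ⊢
    lia
  have hc : IsCompl (Set.range e₀) (Set.range e₁) := by
    refine ⟨Set.disjoint_left.mpr ?_, codisjoint_iff.mpr ?_⟩
    · rintro _ ⟨⟨a, b⟩, rfl⟩ ⟨⟨c, d⟩, h⟩
      simp only [e₀, e₁, Prod.mk.injEq] at h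
      lia
    · refine Set.eq_univ_of_forall fun ⟨m, n⟩ ↦ ?_
      rcases Int.even_or_odd' (m + n) with ⟨a, ha | ha⟩
      · exact Or.inl ⟨(a, m - a), by simp only [e₀, Prod.mk.injEq]; lia⟩
      · exact Or.inr ⟨(a, m - a - 1), by simp only [e₁, Prod.mk.injEq]; lia⟩
  set f : ℤ × ℤ → ℂ := fun p ↦
    jacobiTheta₂_term p.1 (u + v) τ * jacobiTheta₂_term p.2 (u - v) τ
  have h0 : HasSum (f ∘ e₀) (jacobiTheta₂ (2 * u) (2 * τ) * jacobiTheta₂ (2 * v) (2 * τ)) := by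
    convert hA using 1
    funext p
    exact jacobiTheta₂_mul_aux p.1 p.2 u v τ
  have h1 : HasSum (f ∘ e₁) (thetaShift u τ * thetaShift v τ) := by
    rw [thetaShift, thetaShift]
    convert hB using 1
    funext p
    exact jacobiTheta₂_mul_aux' p.1 p.2 u v τ
  exact hL.unique (HasSum.add_isCompl hc (i₀.hasSum_range_iff.mpr h0) (i₁.hasSum_range_iff.mpr h1))

/-- The odd theta function `(x; q)_∞ (q / x; q)_∞ (q; q)_∞` at `x = exp (2 π i w)`. -/
noncomputable def thetaOdd (w τ : ℂ) : ℂ := jacobiTheta₂ (w + 1 / 2 - τ / 2) τ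

theorem thetaOdd_eq_qPochhammer (w : ℂ) {τ : ℂ} (hτ : 0 < τ.im) :
    thetaOdd w τ = qPochhammer (qExp w) (qExp τ) * qPochhammer (qExp (τ - w)) (qExp τ) *
      qPochhammer (qExp τ) (qExp τ) := by
  have h : qExp (w + 1 / 2 - τ / 2 + τ / 2) = -qExp w := by
    rw [sub_add_cancel, qExp_add, qExp_half, mul_neg_one]
  rw [thetaOdd, jacobiTheta₂_eq_qPochhammer _ hτ, h, neg_neg, div_neg, neg_neg, qExp_sub]

/-- Shifting `u` by `1/2 - τ/2` interchanges the two coefficient functions up to a common factor and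
one sign, so the product becomes a 2 × 2 determinant in `u` and `v`. -/
theorem thetaOdd_add_mul_sub (u v : ℂ) {τ : ℂ} (hτ : 0 < τ.im) :
    thetaOdd (u + v) τ * thetaOdd (u - v) τ = Complex.exp (Real.pi * Complex.I * (2 * u - τ / 2)) *
      (thetaShift u τ * jacobiTheta₂ (2 * v) (2 * τ) -
        jacobiTheta₂ (2 * u) (2 * τ) * thetaShift v τ) := by
  have e1 : u + v + 1 / 2 - τ / 2 = (u + (1 / 2 - τ / 2)) + v := by ring
  have e2 : u - v + 1 / 2 - τ / 2 = (u + (1 / 2 - τ / 2)) - v := by ring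
  rw [thetaOdd, thetaOdd, e1, e2, jacobiTheta₂_add_mul_sub _ _ hτ]
  have h1 : jacobiTheta₂ (2 * (u + (1 / 2 - τ / 2))) (2 * τ) =
      Complex.exp (Real.pi * Complex.I * (2 * u - τ / 2)) * thetaShift u τ := by
    have e3 : 2 * (u + (1 / 2 - τ / 2)) = 2 * u - τ + 1 := by ring
    have e4 : 2 * u + τ = 2 * u - τ + 2 * τ := by ring
    rw [e3, jacobiTheta₂_add_left, thetaShift, e4, jacobiTheta₂_add_left', ← mul_assoc,
      ← mul_assoc, ← Complex.exp_add, ← Complex.exp_add]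
    conv_lhs => rw [← one_mul (jacobiTheta₂ (2 * u - τ) (2 * τ)), ← Complex.exp_zero]
    ring_nf
  have h2 : thetaShift (u + (1 / 2 - τ / 2)) τ =
      -(Complex.exp (Real.pi * Complex.I * (2 * u - τ / 2)) *
        jacobiTheta₂ (2 * u) (2 * τ)) := by
    have e3 : 2 * (u + (1 / 2 - τ / 2)) + τ = 2 * u + 1 := by ring
    have e4 : (Real.pi * Complex.I * (τ / 2 + 2 * (u + (1 / 2 - τ / 2))) : ℂ) =
      Real.pi * Complex.I * (2 * u - τ / 2) + Real.pi * Complex.I := by ring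
    rw [thetaShift, e3, jacobiTheta₂_add_left, e4, Complex.exp_add, Complex.exp_pi_mul_I]
    ring
  rw [h1, h2]
  ring

/-- The three-term relation of Weierstrass. -/
theorem thetaOdd_three_term (x y z w : ℂ) {τ : ℂ} (hτ : 0 < τ.im) :
    qExp y * (thetaOdd (x + y) τ * thetaOdd (x - y) τ * (thetaOdd (z + w) τ * thetaOdd (z - w) τ)) -
      qExp z *
        (thetaOdd (x + z) τ * thetaOdd (x - z) τ * (thetaOdd (y + w) τ * thetaOdd (y - w) τ)) +
      qExp z *
        (thetaOdd (x + w) τ * thetaOdd (x - w) τ * (thetaOdd (y + z) τ * thetaOdd (y - z) τ))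
      = 0 := by
  have h : ∀ u, Complex.exp (Real.pi * Complex.I * (2 * u - τ / 2)) = qExp u * qExp (-τ / 4) := by
    intro u
    rw [qExp, qExp, ← Complex.exp_add]
    ring_nf
  -- What remains is the Plücker relation among the six 2 × 2 minors of a 2 × 4 matrix. The weights
  -- `qExp y` and `qExp z` equalize the prefactors of the three terms.
  simp only [thetaOdd_add_mul_sub _ _ hτ, h]
  ring

/-! ### Product relations and the identities between I, J and U -/

/-- The product `(q ^ a, q ^ (10 - a); q ^ 10)_∞`. -/
noncomputable def pairProd (a : ℚ) (τ : ℍ) : ℂ :=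
  qPochhammer (qPow a τ) (qPow 10 τ) * qPochhammer (qPow (10 - a) τ) (qPow 10 τ)

theorem qPow_eq_qExp (r : ℚ) (τ : ℍ) : qPow r τ = qExp (r * τ) := by
  rw [qPow, qExp, mul_assoc]

theorem thetaOdd_eq_pairProd (a : ℚ) (τ : ℍ) :
    thetaOdd (a * τ) (10 * τ) = pairProd a τ * qPochhammer (qPow 10 τ) (qPow 10 τ) := by
  have h : 0 < (10 * (τ : ℂ)).im := by simpa using τ.im_pos
  rw [thetaOdd_eq_qPochhammer _ h, pairProd, qPow_eq_qExp, qPow_eq_qExp, qPow_eq_qExp, ← sub_mul]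
  push_cast
  rfl

theorem pairProd_sub_left (a : ℚ) (τ : ℍ) : pairProd (10 - a) τ = pairProd a τ := by
  rw [pairProd, pairProd, sub_sub_cancel, mul_comm]

theorem pairProd_three_term (x y z w : ℚ) (τ : ℍ) :
    qPow y τ * (pairProd (x + y) τ * pairProd (x - y) τ *
      (pairProd (z + w) τ * pairProd (z - w) τ)) -
    qPow z τ * (pairProd (x + z) τ * pairProd (x - z) τ *
      (pairProd (y + w) τ * pairProd (y - w) τ)) +
    qPow z τ * (pairProd (x + w) τ * pairProd (x - w) τ *
      (pairProd (y + z) τ * pairProd (y - z) τ)) = 0 := by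
  have h : 0 < (10 * (τ : ℂ)).im := by simpa using τ.im_pos
  have h1 := thetaOdd_three_term (x * τ) (y * τ) (z * τ) (w * τ) h
  have h10 := norm_qPow_lt_one (r := 10) (by norm_num) τ
  have hne : qPochhammer (qPow 10 τ) (qPow 10 τ) ≠ 0 := qPochhammer_ne_zero h10 h10
  simp only [← add_mul, ← sub_mul, ← Rat.cast_add, ← Rat.cast_sub, thetaOdd_eq_pairProd,
    ← qPow_eq_qExp] at h1
  refine (mul_eq_zero.mp ?_).resolve_right (pow_ne_zero 4 hne)
  linear_combination h1

theorem qPow_add (r s : ℚ) (τ : ℍ) : qPow (r + s) τ = qPow r τ * qPow s τ := by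
  rw [qPow_eq_qExp, qPow_eq_qExp, qPow_eq_qExp, Rat.cast_add, add_mul, qExp_add]

theorem qPow_ne_zero (r : ℚ) (τ : ℍ) : qPow r τ ≠ 0 := Complex.exp_ne_zero _

theorem pairProd_relation_one (τ : ℍ) :
    pairProd 2 τ ^ 2 * pairProd 4 τ ^ 2 - qPow 1 τ * pairProd 1 τ ^ 2 * pairProd 3 τ ^ 2 =
      pairProd 1 τ * pairProd 3 τ * pairProd 5 τ ^ 2 := by
  -- The parameters are chosen so that all sums and differences lie in `1, ..., 5` up to the
  -- symmetry `a ↦ 10 - a`.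
  have h := pairProd_three_term 4 3 2 1 τ
  have h3 : qPow 3 τ = qPow 2 τ * qPow 1 τ := by rw [← qPow_add]; norm_num
  have h7 := pairProd_sub_left 3 τ
  have h6 := pairProd_sub_left 4 τ
  norm_num at h h7 h6
  rw [h7, h6, h3] at h
  refine mul_left_cancel₀ (qPow_ne_zero 2 τ) ?_
  linear_combination -h

theorem pairProd_relation_two (τ : ℍ) :
    pairProd 3 τ ^ 2 * pairProd 4 τ ^ 2 - qPow 2 τ * pairProd 1 τ ^ 2 * pairProd 2 τ ^ 2 =
      pairProd 2 τ * pairProd 4 τ * pairProd 5 τ ^ 2 := by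
  have h := pairProd_three_term (11 / 2) (7 / 2) (3 / 2) (-1 / 2) τ
  have h3 : qPow (7 / 2) τ = qPow (3 / 2) τ * qPow 2 τ := by rw [← qPow_add]; norm_num
  have h7 := pairProd_sub_left 3 τ
  have h6 := pairProd_sub_left 4 τ
  have h9 := pairProd_sub_left 1 τ
  norm_num at h h7 h6 h9
  rw [h7, h6, h9, h3] at h
  refine mul_left_cancel₀ (qPow_ne_zero (3 / 2) τ) ?_
  linear_combination -h

theorem pairProd_ne_zero {a : ℚ} (h0 : 0 < a) (h1 : a < 10) (τ : ℍ) : pairProd a τ ≠ 0 :=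
  have h10 := norm_qPow_lt_one (r := 10) (by norm_num) τ
  mul_ne_zero (qPochhammer_ne_zero (norm_qPow_lt_one h0 τ) h10)
    (qPochhammer_ne_zero (norm_qPow_lt_one (sub_pos.mpr h1) τ) h10)

theorem fracI_eq_pairProd (τ : ℍ) :
    fracI τ = qPow (3 / 4) τ * (pairProd 1 τ / pairProd 4 τ) := by
  rw [fracI, pairProd, pairProd]; norm_num

theorem fracJ_eq_pairProd (τ : ℍ) :
    fracJ τ = qPow (1 / 4) τ * (pairProd 2 τ / pairProd 3 τ) := by
  rw [fracJ, pairProd, pairProd]; norm_num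

theorem inv_sub_fracI_mul_fracJ (τ : ℍ) :
    1 / (fracI τ * fracJ τ) - fracI τ * fracJ τ = 1 / fracU τ ^ 2 - 1 := by
  have r1 := pairProd_relation_one τ
  have r2 := pairProd_relation_two τ
  have n1 : pairProd 1 τ ≠ 0 := pairProd_ne_zero (by norm_num) (by norm_num) τ
  have n2 : pairProd 2 τ ≠ 0 := pairProd_ne_zero (by norm_num) (by norm_num) τ
  have n3 : pairProd 3 τ ≠ 0 := pairProd_ne_zero (by norm_num) (by norm_num) τ
  have n4 : pairProd 4 τ ≠ 0 := pairProd_ne_zero (by norm_num) (by norm_num) τ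
  have q0 : qPow (1 / 4) τ ≠ 0 := qPow_ne_zero _ τ
  have q34 : qPow (3 / 4) τ = qPow (1 / 4) τ ^ 3 := by
    rw [pow_succ, pow_two, ← qPow_add, ← qPow_add]; norm_num
  have q1 : qPow 1 τ = qPow (1 / 4) τ ^ 4 := by
    rw [pow_succ, ← q34, ← qPow_add]; norm_num
  have q2 : qPow 2 τ = qPow (1 / 4) τ ^ 8 := by
    rw [show 8 = 4 + 4 from rfl, pow_add, ← q1, ← qPow_add]; norm_num
  rw [q1] at r1
  rw [q2] at r2
  rw [fracU, fracI_eq_pairProd, fracJ_eq_pairProd, q34]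
  field_simp
  -- With these multipliers both right-hand sides become `P₁P₂P₃P₄P₅²`, so `P₅` cancels.
  linear_combination pairProd 1 τ * pairProd 3 τ * r2 - pairProd 2 τ * pairProd 4 τ * r1

theorem fracI_pow_add (τ : ℍ) :
    fracI τ ^ 4 + 1 / fracJ τ ^ 4 = 1 / fracU τ ^ 2 - 2 + 3 * fracU τ ^ 2 := by
  have h := inv_sub_fracI_mul_fracJ τ
  have hI := fracI_ne_zero τ
  have hJ := fracJ_ne_zero τ
  rw [fracU] at h ⊢
  have h2 : (1 / (fracI τ * fracJ τ) - fracI τ * fracJ τ) ^ 2 =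
    (1 / (fracI τ / fracJ τ) ^ 2 - 1) ^ 2 := by rw [h]
  calc fracI τ ^ 4 + 1 / fracJ τ ^ 4 =
        (fracI τ / fracJ τ) ^ 2 * ((1 / (fracI τ * fracJ τ) - fracI τ * fracJ τ) ^ 2 + 2) := by
        field_simp
        ring
    _ = _ := by
        rw [h2]
        field_simp
        ring

theorem fracJ_pow_add (τ : ℍ) :
    fracJ τ ^ 4 + 1 / fracI τ ^ 4 =
      1 / fracU τ ^ 6 - 2 / fracU τ ^ 4 + 3 / fracU τ ^ 2 := by
  have h := fracI_pow_add τ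
  have hI := fracI_ne_zero τ
  have hJ := fracJ_ne_zero τ
  have hU : fracU τ ≠ 0 := div_ne_zero hI hJ
  have h1 : fracJ τ ^ 4 + 1 / fracI τ ^ 4 = (fracI τ ^ 4 + 1 / fracJ τ ^ 4) / fracU τ ^ 4 := by
    rw [fracU]
    field_simp
  rw [h1, h]
  field_simp

/-! ### The theta constants -/

/-- The theta constant `θ₂(τ) = ∑ exp (π i (n + 1 / 2) ^ 2 τ)`. -/
noncomputable def thetaTwo (τ : ℂ) : ℂ :=
  Complex.exp (Real.pi * Complex.I * τ / 4) * jacobiTheta₂ (τ / 2) τ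

theorem qPochhammer_eq_one_sub_mul (a : ℂ) {q : ℂ} (hq : ‖q‖ < 1) :
    qPochhammer a q = (1 - a) * qPochhammer (a * q) q := by
  have h1 := (tendsto_qPochhammer a hq).comp (Filter.tendsto_add_atTop_nat 1)
  have h2 := (tendsto_qPochhammer (a * q) hq).const_mul (1 - a)
  refine tendsto_nhds_unique h1 (h2.congr fun n ↦ ?_)
  simp only [Function.comp_apply]
  rw [Finset.prod_range_succ', pow_zero, mul_one, mul_comm]
  congr 1
  exact Finset.prod_congr rfl fun k _ ↦ by ring

theorem qPochhammer_mul_neg (a : ℂ) {q : ℂ} (hq : ‖q‖ < 1) :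
    qPochhammer a q * qPochhammer (-a) q = qPochhammer (a ^ 2) (q ^ 2) := by
  have hq2 : ‖q ^ 2‖ < 1 := by rw [norm_pow]; exact pow_lt_one₀ (norm_nonneg _) hq two_ne_zero
  refine tendsto_nhds_unique ((tendsto_qPochhammer a hq).mul (tendsto_qPochhammer (-a) hq))
    ((tendsto_qPochhammer (a ^ 2) hq2).congr fun n ↦ ?_)
  rw [← Finset.prod_mul_distrib]
  exact Finset.prod_congr rfl fun k _ ↦ by ring

/-- The factors are grouped by the residue of the exponent modulo `m`. -/
theorem qPochhammer_eq_prod (a : ℂ) {q : ℂ} (hq : ‖q‖ < 1) {m : ℕ} (hm : m ≠ 0) :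
    qPochhammer a q = ∏ i ∈ Finset.range m, qPochhammer (a * q ^ i) (q ^ m) := by
  have hqm : ‖q ^ m‖ < 1 := by rw [norm_pow]; exact pow_lt_one₀ (norm_nonneg _) hq hm
  have h1 := (tendsto_qPochhammer a hq).comp
    (Filter.tendsto_id.atTop_mul_const' (Nat.pos_of_ne_zero hm) :
      Filter.Tendsto (fun n : ℕ ↦ n * m) Filter.atTop Filter.atTop)
  have h2 := tendsto_finsetProd (Finset.range m)
    fun i _ ↦ tendsto_qPochhammer (a * q ^ i) hqm
  refine tendsto_nhds_unique h1 (h2.congr fun n ↦ ?_)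
  simp only [Function.comp_apply]
  induction n with
  | zero => simp
  | succ n ih =>
    rw [add_mul, one_mul, Finset.prod_range_add, ← ih, ← Finset.prod_mul_distrib]
    refine Finset.prod_congr rfl fun i _ ↦ ?_
    rw [Finset.prod_range_succ]
    ring

/-- The triple product gives `(-1; q)(-q; q)(q; q)`, where `(-1; q) = 2(-q; q)`. Euler's identity
`(-q; q)(q; q²) = 1` (`h3`) removes the remaining negative argument. -/
theorem thetaTwo_mul_qPochhammer {τ : ℂ} (hτ : 0 < τ.im) :
    thetaTwo τ * qPochhammer (qExp τ) (qExp τ ^ 2) =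
      2 * Complex.exp (Real.pi * Complex.I * τ / 4) * qPochhammer (qExp τ ^ 2) (qExp τ ^ 2) := by
  have hq := norm_qExp_lt_one hτ
  rw [thetaTwo, jacobiTheta₂_eq_qPochhammer _ hτ, add_halves, div_self (qExp_ne_zero τ),
    qPochhammer_eq_one_sub_mul (-1) hq, neg_one_mul]
  set q := qExp τ
  have h1 := qPochhammer_mul_neg q hq
  have h2 := qPochhammer_eq_prod q hq two_ne_zero
  rw [Finset.prod_range_succ, Finset.prod_range_one, pow_zero, mul_one, pow_one, ← pow_two] at h2
  have h3 : qPochhammer (-q) q * qPochhammer q (q ^ 2) = 1 := by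
    have hq2 : ‖q ^ 2‖ < 1 := by rw [norm_pow]; exact pow_lt_one₀ (norm_nonneg _) hq two_ne_zero
    refine mul_left_cancel₀ (qPochhammer_ne_zero hq2 hq2) ?_
    nth_rewrite 2 [← h1]
    linear_combination -qPochhammer (-q) q * h2
  linear_combination (2 * Complex.exp (Real.pi * Complex.I * τ / 4) *
    (qPochhammer (-q) q * qPochhammer q q)) * h3 +
    (2 * Complex.exp (Real.pi * Complex.I * τ / 4)) * h1

theorem thetaTwo_ne_zero {τ : ℂ} (hτ : 0 < τ.im) : thetaTwo τ ≠ 0 := by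
  have hq := norm_qExp_lt_one hτ
  have hq2 : ‖qExp τ ^ 2‖ < 1 := by
    rw [norm_pow]; exact pow_lt_one₀ (norm_nonneg _) hq two_ne_zero
  intro h
  have h1 := thetaTwo_mul_qPochhammer hτ
  rw [h, zero_mul] at h1
  exact mul_ne_zero (mul_ne_zero two_ne_zero (Complex.exp_ne_zero _))
    (qPochhammer_ne_zero hq2 hq2) h1.symm

/-- Splitting `(q; q²)` and `(q²; q²)` into five residue classes gives `P₁P₃(q⁵; q¹⁰)` and
`P₂P₄(q¹⁰; q¹⁰)`. The last factors are those of `θ₂(5τ)` and cancel, leaving `q^(1/2) P₁P₃/(P₂P₄)`.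
-/
theorem fracU_eq_thetaTwo (τ : ℍ) : fracU τ = thetaTwo (5 * τ) / thetaTwo τ := by
  have hτ := τ.im_pos
  have h5τ : 0 < (5 * (τ : ℂ)).im := by simpa using hτ
  have hq := norm_qExp_lt_one hτ
  have hp : ∀ n : ℕ, qPow n τ = qExp τ ^ n := fun n ↦ by
    rw [qPow_eq_qExp, ← qExp_nat_mul]; norm_num
  have h1 := thetaTwo_mul_qPochhammer hτ
  have h5 := thetaTwo_mul_qPochhammer h5τ
  have e5 : qExp (5 * τ) = qExp τ ^ 5 := by rw [← qExp_nat_mul]; norm_num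
  have hnorm : ∀ n : ℕ, n ≠ 0 → ‖qExp τ ^ n‖ < 1 := fun n hn ↦ by
    rw [norm_pow]; exact pow_lt_one₀ (norm_nonneg _) hq hn
  have m1 := qPochhammer_eq_prod (qExp τ) (hnorm 2 (by norm_num)) (m := 5) (by norm_num)
  have m2 := qPochhammer_eq_prod (qExp τ ^ 2) (hnorm 2 (by norm_num)) (m := 5) (by norm_num)
  have p1 : pairProd 1 τ = qPochhammer (qExp τ) (qExp τ ^ 10) *
      qPochhammer (qExp τ ^ 9) (qExp τ ^ 10) := by
    have a := hp 1; have b := hp 9; have c := hp 10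
    norm_num at a b c
    rw [pairProd, show (10 - 1 : ℚ) = 9 by norm_num, a, b, c]
  have p2 : pairProd 2 τ = qPochhammer (qExp τ ^ 2) (qExp τ ^ 10) *
      qPochhammer (qExp τ ^ 8) (qExp τ ^ 10) := by
    have a := hp 2; have b := hp 8; have c := hp 10
    norm_num at a b c
    rw [pairProd, show (10 - 2 : ℚ) = 8 by norm_num, a, b, c]
  have p3 : pairProd 3 τ = qPochhammer (qExp τ ^ 3) (qExp τ ^ 10) *
      qPochhammer (qExp τ ^ 7) (qExp τ ^ 10) := by
    have a := hp 3; have b := hp 7; have c := hp 10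
    norm_num at a b c
    rw [pairProd, show (10 - 3 : ℚ) = 7 by norm_num, a, b, c]
  have p4 : pairProd 4 τ = qPochhammer (qExp τ ^ 4) (qExp τ ^ 10) *
      qPochhammer (qExp τ ^ 6) (qExp τ ^ 10) := by
    have a := hp 4; have b := hp 6; have c := hp 10
    norm_num at a b c
    rw [pairProd, show (10 - 4 : ℚ) = 6 by norm_num, a, b, c]
  have n1 : pairProd 1 τ ≠ 0 := pairProd_ne_zero (by norm_num) (by norm_num) τ
  have n2 : pairProd 2 τ ≠ 0 := pairProd_ne_zero (by norm_num) (by norm_num) τ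
  have n3 : pairProd 3 τ ≠ 0 := pairProd_ne_zero (by norm_num) (by norm_num) τ
  have n4 : pairProd 4 τ ≠ 0 := pairProd_ne_zero (by norm_num) (by norm_num) τ
  have n5 := qPochhammer_ne_zero (hnorm 5 (by norm_num)) (hnorm 10 (by norm_num))
  have n10 := qPochhammer_ne_zero (hnorm 10 (by norm_num)) (hnorm 10 (by norm_num))
  have m1' : qPochhammer (qExp τ) (qExp τ ^ 2) =
      pairProd 1 τ * pairProd 3 τ * qPochhammer (qExp τ ^ 5) (qExp τ ^ 10) := by
    rw [m1, p1, p3]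
    simp only [Finset.prod_range_succ, Finset.prod_range_zero]
    ring_nf
  have m2' : qPochhammer (qExp τ ^ 2) (qExp τ ^ 2) =
      pairProd 2 τ * pairProd 4 τ * qPochhammer (qExp τ ^ 10) (qExp τ ^ 10) := by
    rw [m2, p2, p4]
    simp only [Finset.prod_range_succ, Finset.prod_range_zero]
    ring_nf
  have hexp : ∀ (r : ℚ) (z : ℂ), (r : ℂ) * (τ : ℂ) = z / 8 →
      qPow r τ = Complex.exp (Real.pi * Complex.I * z / 4) := by
    intro r z h
    rw [qPow, mul_assoc, h]
    ring_nf
  rw [e5, ← hexp (5 / 8) (5 * τ) (by push_cast; ring)] at h5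
  rw [m1', m2', ← hexp (1 / 8) τ (by push_cast; ring)] at h1
  have hA : qPow (5 / 8) τ = qPow (1 / 2) τ * qPow (1 / 8) τ := by rw [← qPow_add]; norm_num
  have hB : qPow (3 / 4) τ = qPow (1 / 2) τ * qPow (1 / 4) τ := by rw [← qPow_add]; norm_num
  have q8 := qPow_ne_zero (1 / 8) τ
  have q4 := qPow_ne_zero (1 / 4) τ
  have t5 : thetaTwo (5 * τ) = 2 * qPow (5 / 8) τ * qPochhammer (qExp τ ^ 10) (qExp τ ^ 10) /
      qPochhammer (qExp τ ^ 5) (qExp τ ^ 10) := by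
    rw [eq_div_iff n5, ← pow_mul] at *
    exact h5
  have t1 : thetaTwo τ = 2 * qPow (1 / 8) τ * (pairProd 2 τ * pairProd 4 τ *
      qPochhammer (qExp τ ^ 10) (qExp τ ^ 10)) / (pairProd 1 τ * pairProd 3 τ *
      qPochhammer (qExp τ ^ 5) (qExp τ ^ 10)) := by
    rw [eq_div_iff (mul_ne_zero (mul_ne_zero n1 n3) n5)]
    exact h1
  rw [fracU, fracI_eq_pairProd, fracJ_eq_pairProd, t5, t1, hA, hB]
  field_simp

/-! ### Modular transformations of the theta constants -/

theorem jacobiTheta₂_add_one_right (z τ : ℂ) :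
    jacobiTheta₂ z (τ + 1) = jacobiTheta₂ (z + 1 / 2) τ := by
  refine tsum_congr fun n ↦ ?_
  rw [jacobiTheta₂_term, jacobiTheta₂_term, Complex.exp_eq_exp_iff_exists_int]
  obtain ⟨m, hm⟩ := Int.even_mul_succ_self (n - 1)
  refine ⟨m, ?_⟩
  have hm' : ((n : ℂ) - 1) * n = m + m := by
    have := congrArg (Int.cast : ℤ → ℂ) hm
    push_cast at this
    rw [← this]; ring
  linear_combination (Real.pi * Complex.I) * hm'

/-- Working with squares keeps the multipliers among the powers of `I` and, under inversion, avoids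
the branch of `(-iτ)^(1/2)`. -/
theorem thetaTwo_sq_add_one (τ : ℂ) : thetaTwo (τ + 1) ^ 2 = Complex.I * thetaTwo τ ^ 2 := by
  have h : τ / 2 + 1 = (τ + 1) / 2 + 1 / 2 := by ring
  rw [thetaTwo, jacobiTheta₂_add_one_right, ← h, jacobiTheta₂_add_left, thetaTwo, mul_pow,
    mul_pow, ← mul_assoc, ← Complex.exp_nat_mul, ← Complex.exp_nat_mul]
  congr 1
  have h2 : ((2 : ℕ) : ℂ) * (Real.pi * Complex.I * (τ + 1) / 4) =
    Real.pi / 2 * Complex.I + (2 : ℕ) * (Real.pi * Complex.I * τ / 4) := by push_cast; ring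
  rw [h2, Complex.exp_add, Complex.exp_pi_div_two_mul_I]

theorem thetaTwo_sq_add_intCast (τ : ℂ) (n : ℤ) :
    thetaTwo (τ + n) ^ 2 = Complex.I ^ n * thetaTwo τ ^ 2 := by
  induction n with
  | zero => simp
  | succ n ih =>
    rw [zpow_add_one₀ Complex.I_ne_zero, Int.cast_add, Int.cast_one, ← add_assoc,
      thetaTwo_sq_add_one, ih]
    ring
  | pred n ih =>
    have h := thetaTwo_sq_add_one (τ + ((-n - 1 : ℤ) : ℂ))
    have e : τ + ((-n - 1 : ℤ) : ℂ) + 1 = τ + ((-n : ℤ) : ℂ) := by push_cast; ring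
    rw [e, ih] at h
    rw [zpow_sub_one₀ Complex.I_ne_zero, mul_right_comm, h, mul_right_comm,
      mul_inv_cancel₀ Complex.I_ne_zero, one_mul]

theorem neg_I_mul_cpow_half_sq (τ : ℂ) : ((-Complex.I * τ) ^ (1 / 2 : ℂ)) ^ 2 = -Complex.I * τ := by
  rw [← Complex.cpow_nat_mul]
  norm_num

theorem im_ne_zero_of_pos {τ : ℂ} (hτ : 0 < τ.im) : τ ≠ 0 := by
  rintro rfl
  simp at hτ

theorem neg_one_div_im_pos {τ : ℂ} (hτ : 0 < τ.im) : 0 < (-1 / τ).im := by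
  rw [neg_div, Complex.neg_im, one_div, Complex.inv_im, neg_div, neg_neg]
  exact div_pos hτ (Complex.normSq_pos.mpr (im_ne_zero_of_pos hτ))

theorem thetaTwo_sq_neg_one_div {τ : ℂ} (hτ : 0 < τ.im) :
    thetaTwo (-1 / τ) ^ 2 = -Complex.I * τ * jacobiTheta₂ (1 / 2) τ ^ 2 := by
  have h := jacobiTheta₂_functional_equation (1 / 2) τ
  have h0 := im_ne_zero_of_pos hτ
  have e1 : (1 / 2 / τ : ℂ) = -(-1 / τ / 2) := by ring
  have e2 : (-Real.pi * Complex.I * (1 / 2) ^ 2 / τ : ℂ) =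
    Real.pi * Complex.I * (-1 / τ) / 4 := by ring
  rw [e1, e2, jacobiTheta₂_neg_left, mul_assoc, ← thetaTwo] at h
  rw [h, mul_pow, div_pow, neg_I_mul_cpow_half_sq, one_pow]
  have := Complex.I_ne_zero
  field_simp

theorem jacobiTheta₂_half_sq_neg_one_div {τ : ℂ} (hτ : 0 < τ.im) :
    jacobiTheta₂ (1 / 2) (-1 / τ) ^ 2 = -Complex.I * τ * thetaTwo τ ^ 2 := by
  have h := jacobiTheta₂_functional_equation (τ / 2) τ
  have h0 := im_ne_zero_of_pos hτ
  have e1 : (τ / 2 / τ : ℂ) = 1 / 2 := by field_simp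
  have e2 : (-Real.pi * Complex.I * (τ / 2) ^ 2 / τ : ℂ) =
    -(Real.pi * Complex.I * τ / 4) := by field_simp; ring
  rw [e1, e2] at h
  rw [thetaTwo, h, Complex.exp_neg, mul_pow, mul_pow, mul_pow, div_pow, neg_I_mul_cpow_half_sq,
    one_pow]
  have := Complex.I_ne_zero
  have := Complex.exp_ne_zero (Real.pi * Complex.I * τ / 4)
  field_simp

theorem jacobiTheta₂_zero_sq_neg_one_div {τ : ℂ} (hτ : 0 < τ.im) :
    jacobiTheta₂ 0 (-1 / τ) ^ 2 = -Complex.I * τ * jacobiTheta₂ 0 τ ^ 2 := by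
  have h := jacobiTheta₂_functional_equation 0 τ
  have h0 := im_ne_zero_of_pos hτ
  rw [h, mul_pow, mul_pow, div_pow, neg_I_mul_cpow_half_sq, one_pow]
  have := Complex.I_ne_zero
  simp only [zero_div]
  field_simp
  simp

theorem jacobiTheta₂_add_two_mul_intCast (z τ : ℂ) (n : ℤ) :
    jacobiTheta₂ z (τ + 2 * n) = jacobiTheta₂ z τ := by
  induction n with
  | zero => simp
  | succ n ih =>
    rw [← ih, ← jacobiTheta₂_add_right z (τ + 2 * ((n : ℤ) : ℂ))]
    push_cast; ring_nf
  | pred n ih =>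
    rw [← ih, ← jacobiTheta₂_add_right z (τ + 2 * ((-n - 1 : ℤ) : ℂ))]
    push_cast; ring_nf

theorem neg_one_div_add_intCast {τ : ℂ} (hτ : 0 < τ.im) (n : ℤ) :
    0 < (-1 / τ + n).im := by
  rw [Complex.add_im, Complex.intCast_im, add_zero]
  exact neg_one_div_im_pos hτ

theorem intCast_mul_add_ne_zero {τ : ℂ} (hτ : 0 < τ.im) {c d : ℤ} (h : c ≠ 0 ∨ d ≠ 0) :
    (c * τ + d : ℂ) ≠ 0 := by
  intro h0
  have h1 := congrArg Complex.im h0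
  rw [Complex.add_im, Complex.intCast_im, add_zero, Complex.mul_im, Complex.intCast_re,
    Complex.intCast_im, zero_mul, add_zero, Complex.zero_im, mul_eq_zero] at h1
  have hc : c = 0 := by exact_mod_cast h1.resolve_right hτ.ne'
  rw [hc, Int.cast_zero, zero_mul, zero_add, Int.cast_eq_zero] at h0
  exact h.elim (fun h ↦ h hc) (fun h ↦ h h0)

theorem div_two_mul_add_one_eq {τ : ℂ} (hτ : 0 < τ.im) (n : ℤ) :
    τ / (2 * n * τ + 1) = -1 / (-1 / τ + ((-2 * n : ℤ) : ℂ)) := by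
  have h0 := im_ne_zero_of_pos hτ
  have h1 := intCast_mul_add_ne_zero hτ (c := 2 * n) (d := 1) (by simp)
  push_cast at h1 ⊢
  have h2 : -1 / τ + -2 * n = -(2 * n * τ + 1) / τ := by field_simp; ring
  rw [h2]
  field_simp

/-- The map is a translation by `-2n` conjugated by inversion; inversion exchanges `θ₂` with `θ₄ =
jacobiTheta₂ (1 / 2)`, which has period 2. -/
theorem thetaTwo_sq_div_two_mul_add_one {τ : ℂ} (hτ : 0 < τ.im) (n : ℤ) :
    thetaTwo (τ / (2 * n * τ + 1)) ^ 2 = (2 * n * τ + 1) * thetaTwo τ ^ 2 := by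
  have h0 := im_ne_zero_of_pos hτ
  have h1 := neg_one_div_add_intCast hτ (-2 * n)
  rw [div_two_mul_add_one_eq hτ, thetaTwo_sq_neg_one_div h1]
  have h2 : ((-2 * n : ℤ) : ℂ) = 2 * ((-n : ℤ) : ℂ) := by push_cast; ring
  rw [h2, jacobiTheta₂_add_two_mul_intCast, jacobiTheta₂_half_sq_neg_one_div hτ]
  push_cast
  field_simp
  linear_combination (-(1 + 2 * τ * n)) * thetaTwo τ ^ 2 * Complex.I_sq

theorem I_zpow_congr {m n : ℤ} (h : (4 : ℤ) ∣ m - n) : Complex.I ^ m = Complex.I ^ n := by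
  obtain ⟨k, hk⟩ := h
  obtain rfl : m = n + 4 * k := by lia
  have h4 : Complex.I ^ (4 : ℤ) = 1 := by exact_mod_cast Complex.I_pow_four
  rw [zpow_add₀ Complex.I_ne_zero, zpow_mul, h4, one_zpow, mul_one]

/-- The square of `θ₂` is modular of weight one on `Γ₀(2)`, with an explicit character. -/
theorem thetaTwo_sq_moebius (N : ℕ) : ∀ a b c d : ℤ, c.natAbs + d.natAbs ≤ N →
    a * d - b * c = 1 → Even c → ∀ τ : ℂ, 0 < τ.im →
    thetaTwo ((a * τ + b) / (c * τ + d)) ^ 2 =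
      Complex.I ^ (b * d + d - 1) * (c * τ + d) * thetaTwo τ ^ 2 := by
  -- Euclidean descent on `|c| + |d|`. As `c` is even and `d` odd, `|c| ≠ |d|`: either `d` is
  -- reduced by `±c` through a translation, or `c` by `±2d` through `τ/(2eτ + 1)`. Both moves keep
  -- `c` even.
  induction N with
  | zero =>
    intro a b c d h hdet
    obtain rfl : c = 0 := by lia
    obtain rfl : d = 0 := by lia
    simp at hdet
  | succ N ih =>
    intro a b c d hN hdet hc τ hτ
    have hdo : Odd d := by
      by_contra hd
      rw [Int.not_odd_iff_even] at hd
      have := (hd.mul_left a).sub (hc.mul_left b)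
      rw [hdet] at this
      exact absurd this (by decide)
    have hao : Odd a := by
      by_contra ha
      rw [Int.not_odd_iff_even] at ha
      have := (ha.mul_right d).sub (hc.mul_left b)
      rw [hdet] at this
      exact absurd this (by decide)
    have hd0 : d ≠ 0 := by rintro rfl; exact absurd hdo (by decide)
    rcases eq_or_ne c 0 with rfl | hc0
    · have had : a * d = 1 := by linarith
      rcases Int.mul_eq_one_iff_eq_one_or_neg_one.mp had with ⟨rfl, rfl⟩ | ⟨rfl, rfl⟩
      · simpa using thetaTwo_sq_add_intCast τ b
      · have h1 := thetaTwo_sq_add_intCast τ (-b)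
        have h2 : Complex.I ^ (b * -1 + -1 - 1) = -Complex.I ^ (-b) := by
          rw [show b * -1 + -1 - 1 = -b + -2 by ring, zpow_add₀ Complex.I_ne_zero]
          have : Complex.I ^ (-2 : ℤ) = -1 := by
            rw [zpow_neg, show (2 : ℤ) = ((2 : ℕ) : ℤ) from rfl, zpow_natCast, Complex.I_sq]
            norm_num
          rw [this, mul_neg_one]
        rw [h2]
        have h3 : ((-1 : ℤ) * τ + b) / ((0 : ℤ) * τ + ((-1 : ℤ) : ℂ)) = τ + ((-b : ℤ) : ℂ) := by
          push_cast; ring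
        rw [h3, h1]
        push_cast; ring
    · have hcd : c.natAbs ≠ d.natAbs := by
        intro h
        rw [← Int.natAbs_even, h, Int.natAbs_even] at hc
        exact Int.not_odd_iff_even.mpr hc hdo
      rcases lt_or_gt_of_ne hcd with hlt | hlt
      · obtain ⟨e, he, hlt'⟩ : ∃ e : ℤ, (e = 1 ∨ e = -1) ∧ (d - e * c).natAbs < d.natAbs := by
          rcases le_total 0 c with h1 | h1 <;> rcases le_total 0 d with h2 | h2
          · exact ⟨1, by simp, by lia⟩
          · exact ⟨-1, by simp, by lia⟩
          · exact ⟨-1, by simp, by lia⟩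
          · exact ⟨1, by simp, by lia⟩
        have hτe : 0 < (τ + e).im := by simpa using hτ
        have h := ih a (b - e * a) c (d - e * c) (by lia)
          (by linear_combination hdet) hc (τ + e) hτe
        rw [thetaTwo_sq_add_intCast] at h
        have e1 : a * (τ + e) + ((b - e * a : ℤ) : ℂ) = a * τ + b := by push_cast; ring
        have e2 : c * (τ + e) + ((d - e * c : ℤ) : ℂ) = c * τ + d := by push_cast; ring
        rw [e1, e2] at h
        have e3 : Complex.I ^ (b * d + d - 1) =
            Complex.I ^ ((b - e * a) * (d - e * c) + (d - e * c) - 1) * Complex.I ^ e := by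
          rw [← zpow_add₀ Complex.I_ne_zero]
          apply I_zpow_congr
          obtain ⟨c', rfl⟩ := hc
          obtain ⟨a', rfl⟩ := hao
          have hd : (2 * a' + 1) * d = 1 + b * (c' + c') := by linear_combination hdet
          have he2 : e * e = 1 := by rcases he with rfl | rfl <;> rfl
          -- A quarter of the exponent difference, computed from `a = 2a' + 1`, `c = 2c'` and the
          -- determinant. The integer division is exact, since `e = ±1`.
          refine ⟨e * c' * b - (e * e) * (a' * c') - c' * ((e * e - e) / 2), ?_⟩
          rw [he2]
          rcases he with rfl | rfl
          · norm_num
            linear_combination hd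
          · norm_num
            linear_combination -hd
        rw [h, e3]; ring
      -- This move leaves `b` and `d`, hence the character, unchanged.
      · obtain ⟨e, he, hlt'⟩ : ∃ e : ℤ, (e = 1 ∨ e = -1) ∧
            (c - 2 * e * d).natAbs < c.natAbs := by
          rcases le_total 0 c with h1 | h1 <;> rcases le_total 0 d with h2 | h2
          · exact ⟨1, by simp, by lia⟩
          · exact ⟨-1, by simp, by lia⟩
          · exact ⟨-1, by simp, by lia⟩
          · exact ⟨1, by simp, by lia⟩
        have hne : (2 * e * τ + 1 : ℂ) ≠ 0 := by
          have := intCast_mul_add_ne_zero hτ (c := 2 * e) (d := 1) (by simp)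
          push_cast at this
          exact this
        have hτe : 0 < (τ / (2 * e * τ + 1)).im := by
          rw [div_two_mul_add_one_eq hτ]
          exact neg_one_div_im_pos (neg_one_div_add_intCast hτ _)
        have h := ih (a - 2 * e * b) b (c - 2 * e * d) d (by lia) (by linear_combination hdet)
          (hc.sub (by rw [mul_assoc]; exact even_two_mul _)) (τ / (2 * e * τ + 1)) hτe
        rw [thetaTwo_sq_div_two_mul_add_one hτ] at h
        have e1 : ((a - 2 * e * b : ℤ) : ℂ) * (τ / (2 * e * τ + 1)) + b =
            (a * τ + b) / (2 * e * τ + 1) := by push_cast; field_simp; ring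
        have e2 : ((c - 2 * e * d : ℤ) : ℂ) * (τ / (2 * e * τ + 1)) + d =
            (c * τ + d) / (2 * e * τ + 1) := by push_cast; field_simp; ring
        rw [e1, e2, div_div_div_cancel_right₀ hne] at h
        have e3 := div_mul_cancel₀ (c * τ + d : ℂ) hne
        rw [h]
        linear_combination (Complex.I ^ (b * d + d - 1) * thetaTwo τ ^ 2) * e3

/-! ### A criterion for modular functions without poles in the upper half-plane -/

theorem coe_SL_smul (γ : SL(2, ℤ)) (τ : ℍ) :
    ((γ • τ : ℍ) : ℂ) = ((γ 0 0 : ℤ) * τ + (γ 0 1 : ℤ)) / ((γ 1 0 : ℤ) * τ + (γ 1 1 : ℤ)) := by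
  rw [coe_specialLinearGroup_apply]
  simp

theorem coe_S_smul (τ : ℍ) : ((ModularGroup.S • τ : ℍ) : ℂ) = -1 / τ := by
  rw [modular_S_smul]
  simp [neg_div, inv_neg]

theorem coe_T_smul (τ : ℍ) : ((ModularGroup.T • τ : ℍ) : ℂ) = τ + 1 := by
  rw [modular_T_smul, coe_vadd, add_comm]; simp

theorem exists_isCuspWidth (Γ : Subgroup SL(2, ℤ)) [Γ.FiniteIndex] (γ : SL(2, ℤ)) :
    ∃ h : ℕ, IsCuspWidth Γ γ h := by
  obtain ⟨n, hn, -, hmem⟩ := Subgroup.exists_pow_mem_of_index_ne_zero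
    (Subgroup.FiniteIndex.index_ne_zero (H := Γ)) (γ * ModularGroup.T * γ⁻¹)
  rw [conj_pow] at hmem
  have hne : {m : ℕ | 0 < m ∧ (γ * ModularGroup.T ^ m * γ⁻¹ ∈ Γ ∨
    -(γ * ModularGroup.T ^ m * γ⁻¹) ∈ Γ)}.Nonempty := ⟨n, hn, Or.inl hmem⟩
  exact ⟨_, Nat.sInf_mem hne, fun m hm ↦ Nat.sInf_le hm⟩

theorem IsCuspWidth.smul_vadd {Γ : Subgroup SL(2, ℤ)} {γ : SL(2, ℤ)} {h : ℕ}
    (hw : IsCuspWidth Γ γ h) {f : ℍ → ℂ} (hf : ∀ γ ∈ Γ, ∀ τ : ℍ, f (γ • τ) = f τ) (τ : ℍ) :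
    f (γ • ((h : ℝ) +ᵥ τ)) = f (γ • τ) := by
  have h1 : γ • ((h : ℝ) +ᵥ τ) = (γ * ModularGroup.T ^ h * γ⁻¹) • γ • τ := by
    have h2 := modular_T_zpow_smul τ h
    rw [zpow_natCast, Int.cast_natCast] at h2
    rw [mul_smul, mul_smul, inv_smul_smul, h2]
  rw [h1]
  rcases hw.1.2 with hm | hm
  · exact hf _ hm _
  · rw [← hf _ hm (γ • τ), ModularGroup.SL_neg_smul]

theorem differentiableOn_comp_smul {f : ℍ → ℂ}
    (hf : DifferentiableOn ℂ (f ∘ ofComplex) {z : ℂ | 0 < z.im}) (γ : SL(2, ℤ)) :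
    DifferentiableOn ℂ ((fun τ : ℍ ↦ f (γ • τ)) ∘ ofComplex) {z : ℂ | 0 < z.im} := by
  have hg : DifferentiableOn ℂ
      (fun z : ℂ ↦ ((γ 0 0 : ℤ) * z + (γ 0 1 : ℤ)) / ((γ 1 0 : ℤ) * z + (γ 1 1 : ℤ)))
      {z : ℂ | 0 < z.im} := by
    refine DifferentiableOn.div (by fun_prop) (by fun_prop) fun z hz ↦ ?_
    refine intCast_mul_add_ne_zero hz ?_
    by_contra! h
    have := Matrix.SpecialLinearGroup.det_coe γ
    rw [Matrix.det_fin_two, h.1, h.2] at this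
    simp at this
  have he : ∀ z : ℂ, (hz : 0 < z.im) →
      ((γ 0 0 : ℤ) * z + (γ 0 1 : ℤ)) / ((γ 1 0 : ℤ) * z + (γ 1 1 : ℤ)) =
        ((γ • (⟨z, hz⟩ : ℍ) : ℍ) : ℂ) := fun z hz ↦ (coe_SL_smul γ ⟨z, hz⟩).symm
  refine (hf.comp hg fun z hz ↦ ?_).congr fun z hz ↦ ?_
  · rw [Set.mem_ofPred_eq, he z hz]
    exact (γ • (⟨z, hz⟩ : ℍ)).im_pos
  · simp only [Function.comp_apply]
    rw [he z hz, ofComplex_apply, ofComplex_apply_of_im_pos hz]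

theorem qParam_add_self {h : ℝ} (hh : h ≠ 0) (z : ℂ) :
    Function.Periodic.qParam h (z + h) = Function.Periodic.qParam h z := by
  have hh' : (h : ℂ) ≠ 0 := by exact_mod_cast hh
  have e : 2 * Real.pi * Complex.I * (z + h) / h =
    2 * Real.pi * Complex.I * z / h + 2 * Real.pi * Complex.I := by field_simp
  rw [Function.Periodic.qParam, Function.Periodic.qParam, e, Complex.exp_periodic]

theorem qPow_div_eq_qParam_zpow (m : ℤ) (h : ℕ) (τ : ℍ) :
    qPow ((m : ℚ) / (h : ℚ)) τ = Function.Periodic.qParam h τ ^ m := by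
  rw [qPow, Function.Periodic.qParam, ← Complex.exp_int_mul]
  congr 1
  push_cast
  ring

/-- A holomorphic function which is invariant under `Γ` and grows at most exponentially at every
cusp is a modular function. -/
theorem isModularFunction_of_growth {Γ : Subgroup SL(2, ℤ)} [Γ.FiniteIndex] {f : ℍ → ℂ}
    (hf : DifferentiableOn ℂ (f ∘ ofComplex) {z : ℂ | 0 < z.im})
    (hinv : ∀ γ ∈ Γ, ∀ τ : ℍ, f (γ • τ) = f τ)
    (hgrowth : ∀ γ : SL(2, ℤ), ∃ C B : ℝ, ∀ τ : ℍ, B < τ.im →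
      ‖f (γ • τ)‖ ≤ Real.exp (C * τ.im)) :
    IsModularFunction Γ f where
  meromorphic :=
    (hf.analyticOnNhd (isOpen_lt continuous_const Complex.continuous_im)).meromorphicNFOn
  invariant := hinv
  meromorphic_at_cusps γ := by
    obtain ⟨h, hw⟩ := exists_isCuspWidth Γ γ
    refine ⟨h, hw, ?_⟩
    obtain ⟨C, B, hCB⟩ := hgrowth γ
    have hh : (0 : ℝ) < h := by exact_mod_cast hw.1.1
    -- `|qParam|^N = exp(-2πN im τ / h)` then absorbs the growth `exp(C im τ)`, so `g` is bounded at
    -- `i∞` and has an ordinary Taylor expansion in `qParam`.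
    obtain ⟨N, hN⟩ := exists_nat_ge (C * h / (2 * Real.pi))
    rw [div_le_iff₀ (by positivity)] at hN
    set g : ℍ → ℂ := fun τ ↦ Function.Periodic.qParam h τ ^ N * f (γ • τ)
    have hper : Function.Periodic (g ∘ ofComplex) (h : ℝ) := by
      intro w
      by_cases hw0 : 0 < w.im
      · have hw1 : 0 < (w + ((h : ℝ) : ℂ)).im := by simpa using hw0
        have hv : (⟨w + ((h : ℝ) : ℂ), hw1⟩ : ℍ) = (h : ℝ) +ᵥ (⟨w, hw0⟩ : ℍ) := by
          ext; simp [add_comm]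
        simp only [Function.comp_apply, ofComplex_apply_of_im_pos hw0,
          ofComplex_apply_of_im_pos hw1, hv, g]
        rw [← hv, UpperHalfPlane.coe_mk, hv, hw.smul_vadd hinv, qParam_add_self hh.ne']
      -- Outside the upper half-plane `ofComplex` takes a constant default value, so periodicity is
      -- trivial there.
      · have hw1 : (w + ((h : ℝ) : ℂ)).im ≤ 0 := by simpa using hw0
        simp only [Function.comp_apply, ofComplex_apply_of_im_nonpos (not_lt.mp hw0),
          ofComplex_apply_of_im_nonpos hw1]
    have hhol : DifferentiableOn ℂ (g ∘ ofComplex) {z : ℂ | 0 < z.im} := by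
      have h1 : DifferentiableOn ℂ (fun z ↦ Function.Periodic.qParam h z ^ N) {z : ℂ | 0 < z.im} :=
        (Function.Periodic.differentiable_qParam.pow N).differentiableOn
      refine (h1.mul (differentiableOn_comp_smul hf γ)).congr fun z hz ↦ ?_
      simp only [Function.comp_apply, g, Pi.mul_apply, ofComplex_apply_of_im_pos hz]
    have hbdd : IsBoundedAtImInfty g := by
      rw [isBoundedAtImInfty_iff]
      refine ⟨1, B + 1, fun τ hτ ↦ ?_⟩
      rw [norm_mul, norm_pow, Function.Periodic.norm_qParam, ← Real.exp_nat_mul]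
      refine (mul_le_mul_of_nonneg_left (hCB τ (by linarith)) (Real.exp_nonneg _)).trans ?_
      rw [← Real.exp_add, Real.exp_le_one_iff]
      have hτ0 := τ.im_pos
      have e : N * (-2 * Real.pi * τ.im / h) + C * τ.im =
        (C * h - N * (2 * Real.pi)) * (τ.im / h) := by field_simp; ring
      rw [UpperHalfPlane.coe_im, e]
      exact mul_nonpos_of_nonpos_of_nonneg (by linarith) (by positivity)
    refine ⟨-N, fun n ↦ (qExpansion h g).coeff (n + N).toNat, 0, fun τ _ ↦ ?_⟩
    have hsum := (hasSum_qExpansion hh hper (mdifferentiable_iff.mpr hhol) hbdd τ).mul_left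
      ((Function.Periodic.qParam h τ ^ N)⁻¹)
    have hq : Function.Periodic.qParam h (τ : ℂ) ≠ 0 := Function.Periodic.qParam_ne_zero _
    rw [inv_mul_cancel_left₀ (pow_ne_zero N hq)] at hsum
    have hterm : (fun k : ℕ ↦ (qExpansion h g).coeff (-(N : ℤ) + k + N).toNat *
        qPow (((-N + k : ℤ) : ℚ) / (h : ℚ)) τ) = fun k : ℕ ↦
        (Function.Periodic.qParam h τ ^ N)⁻¹ *
          (qExpansion h g).coeff k • Function.Periodic.qParam h τ ^ k := by
      funext k
      have e : -(N : ℤ) + k + N = k := by ring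
      rw [e, Int.toNat_natCast, qPow_div_eq_qParam_zpow, zpow_add₀ hq, zpow_neg, zpow_natCast,
        zpow_natCast, smul_eq_mul]
      ring
    rw [hterm]
    exact hsum

/-! ### Invariance and growth of `U` -/

theorem SL_apply_one_zero_or_one_one_ne_zero (γ : SL(2, ℤ)) : γ 1 0 ≠ 0 ∨ γ 1 1 ≠ 0 := by
  by_contra! h
  have := Matrix.SpecialLinearGroup.det_coe γ
  rw [Matrix.det_fin_two, h.1, h.2] at this
  simp at this

/-- `5(γτ) = γ'(5τ)` with `γ' = (a, 5b; c/5, d)`, whose lower-left entry is still even. Both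
automorphy factors equal `cτ + d`, and the characters agree because `5bd ≡ bd` modulo 4. -/
theorem fracU_sq_smul {γ : SL(2, ℤ)} (hγ : γ ∈ CongruenceSubgroup.Gamma0 10) (τ : ℍ) :
    fracU (γ • τ) ^ 2 = fracU τ ^ 2 := by
  have hdet := Matrix.SpecialLinearGroup.det_coe γ
  rw [Matrix.det_fin_two] at hdet
  have hne := intCast_mul_add_ne_zero τ.im_pos (SL_apply_one_zero_or_one_one_ne_zero γ)
  have hcoe := coe_SL_smul γ τ
  have h10 : (10 : ℤ) ∣ γ 1 0 := by
    have h := CongruenceSubgroup.Gamma0_mem.mp hγ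
    exact_mod_cast (ZMod.intCast_zmod_eq_zero_iff_dvd _ _).mp h
  generalize γ 0 0 = a at *
  generalize γ 0 1 = b at *
  generalize γ 1 1 = d at *
  obtain ⟨c, hc⟩ := h10
  rw [hc] at hdet hne hcoe
  have h5τ : 0 < (5 * (τ : ℂ)).im := by simpa using τ.im_pos
  have h1 := thetaTwo_sq_moebius _ a b (10 * c) d le_rfl hdet
    ⟨5 * c, by ring⟩ τ τ.im_pos
  have h5 := thetaTwo_sq_moebius _ a (5 * b) (2 * c) d le_rfl (by linear_combination hdet)
    (even_two_mul c) (5 * τ) h5τ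
  have e1 : (a * (5 * (τ : ℂ)) + ((5 * b : ℤ) : ℂ)) / (((2 * c : ℤ) : ℂ) * (5 * (τ : ℂ)) + d) =
      5 * ((γ • τ : ℍ) : ℂ) := by
    rw [hcoe, ← mul_div_assoc]
    push_cast
    congr 1 <;> ring
  have e2 : ((2 * c : ℤ) : ℂ) * (5 * τ) + d = ((10 * c : ℤ) : ℂ) * τ + d := by push_cast; ring
  have e3 : Complex.I ^ (5 * b * d + d - 1) = Complex.I ^ (b * d + d - 1) :=
    I_zpow_congr ⟨b * d, by ring⟩
  rw [e1, e2, e3] at h5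
  rw [← hcoe] at h1
  rw [fracU_eq_thetaTwo, fracU_eq_thetaTwo, div_pow, div_pow, h1, h5]
  exact mul_div_mul_left _ _ (mul_ne_zero (zpow_ne_zero _ Complex.I_ne_zero) hne)

/-! ### Growth of U at the cusps -/

/-- The three even theta constants. -/
noncomputable def thetaConst : Fin 3 → ℂ → ℂ :=
  ![thetaTwo, fun τ ↦ jacobiTheta₂ 0 τ, fun τ ↦ jacobiTheta₂ (1 / 2) τ]

/-- The invariant height `|θ(τ)| ^ 4 im τ` of a theta constant. -/
noncomputable def thetaHeight (j : Fin 3) (τ : ℍ) : ℝ := ‖thetaConst j τ ^ 2‖ ^ 2 * τ.im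

theorem thetaHeight_S_smul_aux {j k : Fin 3} (τ : ℍ)
    (h : thetaConst j (-1 / τ) ^ 2 = -Complex.I * τ * thetaConst k τ ^ 2) :
    thetaHeight j (ModularGroup.S • τ) = thetaHeight k τ := by
  have him : (ModularGroup.S • τ).im = τ.im / ‖(τ : ℂ)‖ ^ 2 := by
    rw [← UpperHalfPlane.coe_im, coe_S_smul, neg_div, Complex.neg_im, one_div, Complex.inv_im,
      neg_div, neg_neg, Complex.normSq_eq_norm_sq, UpperHalfPlane.coe_im]
  have hτ : ‖(τ : ℂ)‖ ≠ 0 := norm_ne_zero_iff.mpr (im_ne_zero_of_pos τ.im_pos)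
  rw [thetaHeight, thetaHeight, him, coe_S_smul, h, norm_mul, norm_mul, norm_neg, Complex.norm_I]
  field_simp

theorem thetaHeight_T_smul_aux {j k : Fin 3} (τ : ℍ)
    (h : ‖thetaConst j (τ + 1) ^ 2‖ = ‖thetaConst k τ ^ 2‖) :
    thetaHeight j (ModularGroup.T • τ) = thetaHeight k τ := by
  have him : (ModularGroup.T • τ).im = τ.im := by
    rw [← UpperHalfPlane.coe_im, coe_T_smul, Complex.add_im, Complex.one_im, add_zero,
      UpperHalfPlane.coe_im]
  rw [thetaHeight, thetaHeight, him, coe_T_smul, h]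

/-- In absolute value `S` exchanges `θ₂` with `θ₄` and `T` exchanges `θ₃` with `θ₄`; these generate
`SL(2, ℤ)`. Estimates at any cusp thus reduce to estimates at `i∞`. -/
theorem thetaHeight_smul (γ : SL(2, ℤ)) :
    ∃ σ : Equiv.Perm (Fin 3), ∀ j τ, thetaHeight j (γ • τ) = thetaHeight (σ j) τ := by
  have hγ : γ ∈ Subgroup.closure {ModularGroup.S, ModularGroup.T} := by
    rw [SpecialLinearGroup.SL2Z_generators]; trivial
  induction hγ using Subgroup.closure_induction with
  | mem x hx =>
    rcases hx with rfl | rfl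
    · refine ⟨Equiv.swap 0 2, fun j τ ↦ thetaHeight_S_smul_aux τ ?_⟩
      fin_cases j
      · exact thetaTwo_sq_neg_one_div τ.im_pos
      · exact jacobiTheta₂_zero_sq_neg_one_div τ.im_pos
      · exact jacobiTheta₂_half_sq_neg_one_div τ.im_pos
    · refine ⟨Equiv.swap 1 2, fun j τ ↦ thetaHeight_T_smul_aux τ ?_⟩
      fin_cases j
      · change ‖thetaTwo (τ + 1) ^ 2‖ = ‖thetaTwo τ ^ 2‖
        rw [thetaTwo_sq_add_one, norm_mul, Complex.norm_I, one_mul]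
      · change ‖jacobiTheta₂ 0 (τ + 1) ^ 2‖ = ‖jacobiTheta₂ (1 / 2) τ ^ 2‖
        rw [jacobiTheta₂_add_one_right, zero_add]
      · change ‖jacobiTheta₂ (1 / 2) (τ + 1) ^ 2‖ = ‖jacobiTheta₂ 0 τ ^ 2‖
        rw [jacobiTheta₂_add_one_right, add_halves, ← jacobiTheta₂_add_left 0, zero_add]
  | one => exact ⟨1, fun j τ ↦ by simp⟩
  | mul x y _ _ hx hy =>
    obtain ⟨σ, hσ⟩ := hx
    obtain ⟨ρ, hρ⟩ := hy
    exact ⟨ρ * σ, fun j τ ↦ by rw [mul_smul, hσ, hρ, Equiv.Perm.mul_apply]⟩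
  | inv x _ hx =>
    obtain ⟨σ, hσ⟩ := hx
    refine ⟨σ.symm, fun j τ ↦ ?_⟩
    have h := hσ (σ.symm j) (x⁻¹ • τ)
    rw [smul_inv_smul, Equiv.apply_symm_apply] at h
    exact h.symm

/-- The terms have norm `exp(-π n(n+1) im τ)`, so only `n = 0` and `n = -1` survive; the values at
`τ = i` dominate. -/
theorem tendsto_jacobiTheta₂_half_self :
    Filter.Tendsto (fun τ : ℍ ↦ jacobiTheta₂ ((τ : ℂ) / 2) τ) atImInfty (nhds 2) := by
  let g : ℤ → ℂ := fun n ↦ if n = 0 ∨ n = -1 then 1 else 0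
  have hg : ∑' n, g n = 2 := by
    rw [tsum_eq_sum (s := {0, -1}) (fun n hn ↦ by
      simp only [Finset.mem_insert, Finset.mem_singleton] at hn
      simp only [g, if_neg hn])]
    rw [Finset.sum_pair (by decide)]
    norm_num [g]
  have hnorm : ∀ (n : ℤ) (τ : ℍ), ‖jacobiTheta₂_term n ((τ : ℂ) / 2) τ‖ =
      Real.exp (-(Real.pi * ((n * (n + 1) : ℤ) : ℝ) * τ.im)) := by
    intro n τ
    rw [norm_jacobiTheta₂_term]
    congr 1
    have : ((τ : ℂ) / 2).im = τ.im / 2 := by simp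
    rw [this, UpperHalfPlane.coe_im]
    push_cast
    ring
  have hnn : ∀ n : ℤ, 0 ≤ n * (n + 1) := fun n ↦ by
    rcases le_or_gt 0 n with h | h
    · positivity
    · exact mul_nonneg_of_nonpos_of_nonpos (by lia) (by lia)
  suffices h : Filter.Tendsto (fun τ : ℍ ↦ jacobiTheta₂ ((τ : ℂ) / 2) τ) atImInfty
      (nhds (∑' n, g n)) by rwa [hg] at h
  refine tendsto_tsum_of_dominated_convergence
    (bound := fun n ↦ ‖jacobiTheta₂_term n ((UpperHalfPlane.I : ℂ) / 2) UpperHalfPlane.I‖) ?_ ?_ ?_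
  · exact ((summable_jacobiTheta₂_term_iff _ _).mpr UpperHalfPlane.I.im_pos).norm
  · intro n
    by_cases hn : n = 0 ∨ n = -1
    · simp only [g, if_pos hn]
      refine tendsto_const_nhds.congr fun τ ↦ ?_
      rcases hn with rfl | rfl
      · simp [jacobiTheta₂_term]
      · rw [jacobiTheta₂_term, ← Complex.exp_zero]
        push_cast
        ring_nf
    · simp only [g, if_neg hn]
      rw [tendsto_zero_iff_norm_tendsto_zero]
      simp only [hnorm]
      rw [Real.tendsto_exp_comp_nhds_zero, Filter.tendsto_neg_atBot_iff]
      refine Filter.Tendsto.const_mul_atTop ?_ Filter.tendsto_comap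
      have h1 : (0 : ℤ) < n * (n + 1) := by
        refine lt_of_le_of_ne (hnn n) fun h ↦ hn ?_
        rcases mul_eq_zero.mp h.symm with h | h
        · exact Or.inl h
        · exact Or.inr (by lia)
      have h2 : (0 : ℝ) < ((n * (n + 1) : ℤ) : ℝ) := by exact_mod_cast h1
      have := Real.pi_pos
      positivity
  · have h1 : ∀ᶠ τ : ℍ in atImInfty, 1 ≤ τ.im :=
      (atImInfty_mem _).mpr ⟨1, fun z hz ↦ hz⟩
    filter_upwards [h1] with τ hτ n
    rw [hnorm, hnorm, UpperHalfPlane.I_im]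
    have h2 : (0 : ℝ) ≤ ((n * (n + 1) : ℤ) : ℝ) := by exact_mod_cast hnn n
    have := Real.pi_pos
    gcongr

theorem norm_jacobiTheta_sub_one_le_half {τ : ℂ} (hτ : 1 ≤ τ.im) : ‖jacobiTheta τ - 1‖ ≤ 1 / 2 := by
  refine (norm_jacobiTheta_sub_one_le (zero_lt_one.trans_le hτ)).trans ?_
  -- `1/5` is where the bound `2x/(1 - x)` equals `1/2`.
  have h1 : Real.exp (-Real.pi * τ.im) ≤ 1 / 5 := by
    have h2 : -Real.pi * τ.im ≤ -3 := by nlinarith [Real.pi_gt_three]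
    have h4 : (2 : ℝ) ≤ Real.exp 1 := by linarith [Real.add_one_le_exp (1 : ℝ)]
    have h5 : (8 : ℝ) ≤ Real.exp 3 := by
      have : Real.exp 3 = Real.exp 1 ^ 3 := by rw [← Real.exp_nat_mul]; norm_num
      rw [this]
      calc (8 : ℝ) = 2 ^ 3 := by norm_num
        _ ≤ _ := by gcongr
    calc Real.exp (-Real.pi * τ.im) ≤ Real.exp (-3) := Real.exp_le_exp.mpr h2
      _ = (Real.exp 3)⁻¹ := Real.exp_neg 3
      _ ≤ (8 : ℝ)⁻¹ := by gcongr
      _ ≤ 1 / 5 := by norm_num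
  have h0 := Real.exp_pos (-Real.pi * τ.im)
  rw [div_mul_eq_mul_div, div_le_iff₀ (by linarith)]
  linarith

/-- Near `i∞`, `θ₃` and `θ₄` are close to 1, while `|θ₂|` is about `2 exp(-π im τ / 4)`; since `π/4
≤ 1`, one lower bound serves all three. -/
theorem thetaConst_bounds : ∃ B : ℝ, ∀ (j : Fin 3) (τ : ℍ), B < τ.im →
    Real.exp (-τ.im) / 2 ≤ ‖thetaConst j τ‖ ∧ ‖thetaConst j τ‖ ≤ 3 := by
  have h1 : ∀ᶠ τ : ℍ in atImInfty, dist (jacobiTheta₂ ((τ : ℂ) / 2) τ) 2 < 1 :=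
    (Metric.tendsto_nhds.mp tendsto_jacobiTheta₂_half_self) 1 one_pos
  obtain ⟨A, hA⟩ := (atImInfty_mem _).mp h1
  have hone : ∀ w : ℂ, ‖w - 1‖ ≤ 1 / 2 → 1 / 2 ≤ ‖w‖ ∧ ‖w‖ ≤ 3 := fun w hw ↦ by
    have h1 := norm_sub_norm_le (1 : ℂ) w
    have h2 := norm_sub_norm_le w 1
    rw [norm_sub_rev] at h1
    rw [norm_one] at h1 h2
    constructor <;> linarith
  refine ⟨max A 1, fun j τ hτ ↦ ?_⟩
  have hτA : A ≤ τ.im := (le_max_left _ _).trans hτ.le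
  have hτ1 : 1 ≤ τ.im := (le_max_right _ _).trans hτ.le
  have hexp1 : Real.exp (-τ.im) ≤ 1 := Real.exp_le_one_iff.mpr (by linarith)
  fin_cases j
  · have h2 := hA τ hτA
    rw [Set.mem_ofPred_eq, dist_eq_norm] at h2
    have h3 := norm_sub_norm_le (2 : ℂ) (jacobiTheta₂ ((τ : ℂ) / 2) τ)
    have h4 := norm_sub_norm_le (jacobiTheta₂ ((τ : ℂ) / 2) τ) 2
    rw [norm_sub_rev] at h3
    rw [Complex.norm_ofNat] at h3 h4
    have h5 : ‖Complex.exp (Real.pi * Complex.I * τ / 4)‖ = Real.exp (-(Real.pi / 4 * τ.im)) := by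
      rw [Complex.norm_exp]
      congr 1
      have : (Real.pi * Complex.I * τ / 4 : ℂ) = ((Real.pi / 4 : ℝ) : ℂ) * (Complex.I * τ) := by
        push_cast; ring
      rw [this, Complex.re_ofReal_mul]
      simp
    have h6 : Real.exp (-τ.im) ≤ Real.exp (-(Real.pi / 4 * τ.im)) := by
      apply Real.exp_le_exp.mpr
      nlinarith [Real.pi_le_four]
    have h7 : Real.exp (-(Real.pi / 4 * τ.im)) ≤ 1 := by
      rw [Real.exp_le_one_iff]
      have := Real.pi_pos
      have := τ.im_pos
      have : 0 ≤ Real.pi / 4 * τ.im := by positivity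
      linarith
    change Real.exp (-τ.im) / 2 ≤ ‖thetaTwo τ‖ ∧ ‖thetaTwo τ‖ ≤ 3
    have h0 := Real.exp_pos (-τ.im)
    rw [thetaTwo, norm_mul, h5]
    constructor <;> nlinarith
  · change Real.exp (-τ.im) / 2 ≤ ‖jacobiTheta₂ 0 τ‖ ∧ ‖jacobiTheta₂ 0 τ‖ ≤ 3
    have h := hone _ (norm_jacobiTheta_sub_one_le_half (τ := τ) hτ1)
    rw [jacobiTheta_eq_jacobiTheta₂] at h
    exact ⟨by linarith [h.1], h.2⟩
  · change Real.exp (-τ.im) / 2 ≤ ‖jacobiTheta₂ (1 / 2) τ‖ ∧ ‖jacobiTheta₂ (1 / 2) τ‖ ≤ 3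
    have h := hone _ (norm_jacobiTheta_sub_one_le_half (τ := τ + 1) (by simpa using hτ1))
    rw [jacobiTheta_eq_jacobiTheta₂, jacobiTheta₂_add_one_right, zero_add] at h
    exact ⟨by linarith [h.1], h.2⟩

theorem thetaHeight_bounds : ∃ C B : ℝ, 0 ≤ C ∧ ∀ (j : Fin 3) (τ : ℍ), B < τ.im →
    Real.exp (-(C * τ.im)) ≤ thetaHeight j τ ∧ thetaHeight j τ ≤ Real.exp (C * τ.im) := by
  obtain ⟨B, hB⟩ := thetaConst_bounds
  -- `81 = 3⁴` is dictated by the upper bound; the lower bound needs only `20 = 4 + 16`.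
  refine ⟨81, max B 1, by norm_num, fun j τ hτ ↦ ?_⟩
  obtain ⟨h1, h2⟩ := hB j τ ((le_max_left _ _).trans_lt hτ)
  have hτ1 : 1 ≤ τ.im := (le_max_right _ _).trans hτ.le
  have e : thetaHeight j τ = ‖thetaConst j τ‖ ^ 4 * τ.im := by
    rw [thetaHeight, norm_pow]; ring
  rw [e]
  constructor
  · have h3 : Real.exp (-(16 * τ.im)) ≤ 1 / 16 := by
      rw [Real.exp_neg, one_div]
      have := Real.add_one_le_exp (16 * τ.im)
      gcongr
      linarith
    calc Real.exp (-(81 * τ.im)) ≤ Real.exp (-(20 * τ.im)) := by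
          apply Real.exp_le_exp.mpr; linarith
      _ = Real.exp (-τ.im) ^ 4 * Real.exp (-(16 * τ.im)) := by
          rw [← Real.exp_nat_mul, ← Real.exp_add]; congr 1; push_cast; ring
      _ ≤ Real.exp (-τ.im) ^ 4 * (1 / 16) := by gcongr
      _ = (Real.exp (-τ.im) / 2) ^ 4 * 1 := by ring
      _ ≤ _ := by gcongr
  · calc ‖thetaConst j τ‖ ^ 4 * τ.im ≤ 3 ^ 4 * τ.im := by
          have := τ.im_pos
          gcongr
      _ ≤ 81 * τ.im + 1 := by linarith
      _ ≤ _ := Real.add_one_le_exp _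

theorem exists_SL_of_det {a b c d : ℤ} (h : a * d - b * c = 1) :
    ∃ γ : SL(2, ℤ), γ 0 0 = a ∧ γ 0 1 = b ∧ γ 1 0 = c ∧ γ 1 1 = d :=
  ⟨⟨!![a, b; c, d], by rw [Matrix.det_fin_two_of, h]⟩, rfl, rfl, rfl, rfl⟩

/-- Multiplication by `5` is transported through the modular group up to an affine map. -/
theorem exists_smul_eq_five_mul (γ : SL(2, ℤ)) :
    ∃ (γ' : SL(2, ℤ)) (r : ℝ), r ≤ 5 ∧ 1 / 5 ≤ r ∧ ∀ τ : ℍ, ∃ τ' : ℍ, τ'.im = r * τ.im ∧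
      ((γ' • τ' : ℍ) : ℂ) = 5 * ((γ • τ : ℍ) : ℂ) := by
  have hdet := Matrix.SpecialLinearGroup.det_coe γ
  rw [Matrix.det_fin_two] at hdet
  -- Factorization of `diag(5, 1)γ` as `γ'` times an upper triangular matrix: `diag(5, 1)` if `5 ∣
  -- c`, otherwise `(1, B; 0, 5)` with `cB ≡ d` modulo 5.
  by_cases h5 : (5 : ℤ) ∣ γ 1 0
  · obtain ⟨c, hc⟩ := h5
    rw [hc] at hdet
    obtain ⟨γ', h00, h01, h10, h11⟩ := exists_SL_of_det (a := γ 0 0) (b := 5 * γ 0 1) (c := c)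
      (d := γ 1 1) (by linear_combination hdet)
    have him : ∀ τ : ℍ, (5 * (τ : ℂ)).im = 5 * τ.im := fun τ ↦ by simp
    refine ⟨γ', 5, le_rfl, by norm_num, fun τ ↦
      ⟨⟨5 * τ, by rw [him]; have := τ.im_pos; positivity⟩, him τ, ?_⟩⟩
    rw [coe_SL_smul γ', coe_SL_smul γ, h00, h01, h10, h11, hc, ← mul_div_assoc,
      UpperHalfPlane.coe_mk]
    push_cast
    congr 1 <;> ring
  · obtain ⟨B, d, hd⟩ : ∃ B d : ℤ, γ 1 1 = γ 1 0 * B + 5 * d := by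
      obtain ⟨u, v, huv⟩ : IsCoprime (γ 1 0) 5 :=
        ((Int.prime_iff_natAbs_prime.mpr
          (by norm_num : Nat.Prime (5 : ℤ).natAbs)).coprime_iff_not_dvd.mpr h5).symm
      exact ⟨γ 1 1 * u, γ 1 1 * v, by linear_combination -γ 1 1 * huv⟩
    rw [hd] at hdet
    obtain ⟨γ', h00, h01, h10, h11⟩ := exists_SL_of_det (a := 5 * γ 0 0)
      (b := γ 0 1 - γ 0 0 * B) (c := γ 1 0) (d := d) (by linear_combination hdet)
    have him : ∀ τ : ℍ, (((τ : ℂ) + B) / 5).im = 1 / 5 * τ.im := fun τ ↦ by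
      simp only [Complex.div_ofNat_im, Complex.add_im, Complex.intCast_im, add_zero]
      rw [UpperHalfPlane.coe_im]; ring
    refine ⟨γ', 1 / 5, by norm_num, le_rfl, fun τ ↦
      ⟨⟨(τ + B) / 5, by rw [him]; have := τ.im_pos; positivity⟩, him τ, ?_⟩⟩
    rw [coe_SL_smul γ', coe_SL_smul γ, h00, h01, h10, h11, hd,
      UpperHalfPlane.coe_mk]
    have e1 : ((5 * γ 0 0 : ℤ) : ℂ) * ((τ + B) / 5) + ((γ 0 1 - γ 0 0 * B : ℤ) : ℂ) =
        γ 0 0 * τ + γ 0 1 := by push_cast; field_simp; ring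
    have e2 : ((γ 1 0 : ℤ) : ℂ) * ((τ + B) / 5) + d =
        (γ 1 0 * τ + ((γ 1 0 * B + 5 * d : ℤ) : ℂ)) / 5 := by push_cast; field_simp; ring
    rw [e1, e2, div_div_eq_mul_div, mul_comm, mul_div_assoc]

theorem fracU_ne_zero (τ : ℍ) : fracU τ ≠ 0 := div_ne_zero (fracI_ne_zero τ) (fracJ_ne_zero τ)

theorem norm_fracU_pow_four (τ τ' : ℍ) (h : (τ' : ℂ) = 5 * τ) :
    ‖fracU τ‖ ^ 4 = thetaHeight 0 τ' / (5 * thetaHeight 0 τ) := by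
  have him : τ'.im = 5 * τ.im := by
    rw [← UpperHalfPlane.coe_im, h, ← UpperHalfPlane.coe_im]; simp
  have e : ∀ τ, thetaHeight 0 τ = ‖thetaTwo τ‖ ^ 4 * τ.im := fun τ ↦ by
    rw [thetaHeight, norm_pow, ← pow_mul]; rfl
  have h1 := norm_ne_zero_iff.mpr (thetaTwo_ne_zero τ.im_pos)
  have h2 := τ.im_pos.ne'
  rw [fracU_eq_thetaTwo, e, e, him, h, norm_div]
  field_simp

theorem fracU_growth (γ : SL(2, ℤ)) : ∃ D B : ℝ, 0 ≤ D ∧ ∀ τ : ℍ, B < τ.im →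
    ‖fracU (γ • τ)‖ ≤ Real.exp (D * τ.im) ∧ ‖fracU (γ • τ)‖⁻¹ ≤ Real.exp (D * τ.im) := by
  obtain ⟨C, B, hC, hB⟩ := thetaHeight_bounds
  obtain ⟨γ', r, hr5, hr1, hγ'⟩ := exists_smul_eq_five_mul γ
  obtain ⟨σ, hσ⟩ := thetaHeight_smul γ
  obtain ⟨ρ, hρ⟩ := thetaHeight_smul γ'
  -- `5C` bounds the height at `τ'`, where `im τ' ≤ 5 im τ`; `C` bounds the one at `τ`, and the last
  -- `5` absorbs the factor 5. The threshold `5B` ensures `B < im τ'`, as `r ≥ 1/5`.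
  refine ⟨6 * C + 5, max (max B (5 * B)) 1, by positivity, fun τ hτ ↦ ?_⟩
  obtain ⟨τ', him, hτ'⟩ := hγ' τ
  have hτ1 : 1 ≤ τ.im := (le_max_right _ _).trans hτ.le
  have hτB : B < τ.im := ((le_max_left _ _).trans (le_max_left _ _)).trans_lt hτ
  have hτ5 : 5 * B < τ.im := ((le_max_right _ _).trans (le_max_left _ _)).trans_lt hτ
  have hτB' : B < τ'.im := by
    rw [him]
    nlinarith
  have hU := norm_fracU_pow_four _ _ hτ'
  rw [hσ, hρ] at hU
  obtain ⟨a1, a2⟩ := hB (ρ 0) τ' hτB'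
  obtain ⟨b1, b2⟩ := hB (σ 0) τ hτB
  have him' : C * τ'.im ≤ 5 * C * τ.im := by
    rw [him]
    have : r * τ.im ≤ 5 * τ.im := by gcongr
    nlinarith
  have a0 := (Real.exp_pos _).trans_le a1
  have b0 := (Real.exp_pos _).trans_le b1
  have hX : 0 ≤ (6 * C + 5) * τ.im := by positivity
  have hpow : ∀ x : ℝ, 0 ≤ x → x ^ 4 ≤ Real.exp ((6 * C + 5) * τ.im) →
      x ≤ Real.exp ((6 * C + 5) * τ.im) := fun x hx h ↦ by
    have h1 := Real.one_le_exp hX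
    exact le_of_pow_le_pow_left₀ four_ne_zero (Real.exp_nonneg _)
      (h.trans (le_self_pow₀ h1 four_ne_zero))
  have h5 : (5 : ℝ) ≤ Real.exp (5 * τ.im) := by linarith [Real.add_one_le_exp (5 * τ.im)]
  constructor
  · refine hpow _ (norm_nonneg _) ?_
    rw [hU, div_le_iff₀ (by positivity)]
    calc thetaHeight (ρ 0) τ' ≤ Real.exp (C * τ'.im) := a2
      _ ≤ Real.exp (5 * C * τ.im) := Real.exp_le_exp.mpr him'
      _ ≤ Real.exp ((6 * C + 5) * τ.im) * Real.exp (-(C * τ.im)) := by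
        rw [← Real.exp_add]
        apply Real.exp_le_exp.mpr
        linarith
      _ ≤ Real.exp ((6 * C + 5) * τ.im) * (5 * thetaHeight (σ 0) τ) := by
        gcongr
        linarith
  · refine hpow _ (inv_nonneg.mpr (norm_nonneg _)) ?_
    rw [inv_pow, hU, inv_div, div_le_iff₀ a0]
    calc 5 * thetaHeight (σ 0) τ ≤ Real.exp (5 * τ.im) * Real.exp (C * τ.im) := by gcongr
      _ ≤ Real.exp ((6 * C + 5) * τ.im) * Real.exp (-(C * τ'.im)) := by
        rw [← Real.exp_add, ← Real.exp_add]
        apply Real.exp_le_exp.mpr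
        linarith
      _ ≤ _ := by gcongr

/-! ### Modularity of the two functions -/

theorem differentiableOn_fracU :
    DifferentiableOn ℂ (fracU ∘ ofComplex) {z : ℂ | 0 < z.im} := by
  have h : ∀ z : ℂ, 0 < z.im → DifferentiableAt ℂ thetaTwo z := fun z hz ↦ by
    have h1 : DifferentiableAt ℂ (fun p : ℂ × ℂ ↦ jacobiTheta₂ p.1 p.2) (z / 2, z) :=
      (hasFDerivAt_jacobiTheta₂ (z / 2) hz).differentiableAt
    have h2 : DifferentiableAt ℂ (fun z : ℂ ↦ (z / 2, z)) z := by fun_prop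
    have h3 : DifferentiableAt ℂ (fun z ↦ jacobiTheta₂ (z / 2) z) z :=
      DifferentiableAt.comp (f := fun z : ℂ ↦ (z / 2, z)) z h1 h2
    have h4 : DifferentiableAt ℂ (fun z : ℂ ↦ Complex.exp (Real.pi * Complex.I * z / 4)) z := by
      fun_prop
    exact h4.mul h3
  intro z hz
  have hz' : 0 < z.im := hz
  have h5z : 0 < (5 * z).im := by simpa using hz'
  have h5 : DifferentiableAt ℂ (fun z ↦ thetaTwo (5 * z)) z :=
    DifferentiableAt.comp (f := fun z : ℂ ↦ 5 * z) z (h _ h5z) (by fun_prop)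
  refine ((h5.div (h z hz') (thetaTwo_ne_zero hz')).differentiableWithinAt).congr ?_ ?_
  · intro w hw
    rw [Function.comp_apply, fracU_eq_thetaTwo, ofComplex_apply_of_im_pos hw]
    rfl
  · rw [Function.comp_apply, fracU_eq_thetaTwo, ofComplex_apply_of_im_pos hz']
    rfl

theorem isModularFunction_fracI_pow_add :
    IsModularFunction (CongruenceSubgroup.Gamma0 10)
      (fun τ : ℍ ↦ fracI τ ^ 4 + 1 / fracJ τ ^ 4) := by
  simp only [fracI_pow_add]
  -- After the rewriting only `U²` and its inverse occur, so holomorphy, invariance and growth are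
  -- inherited from `U`.
  refine isModularFunction_of_growth ?_ (fun γ hγ τ ↦ by rw [fracU_sq_smul hγ]) fun γ ↦ ?_
  · have hU := differentiableOn_fracU
    have hne : ∀ z ∈ {z : ℂ | 0 < z.im}, (fracU ∘ ofComplex) z ^ 2 ≠ 0 :=
      fun z _ ↦ pow_ne_zero 2 (fracU_ne_zero _)
    exact (((differentiableOn_const 1).div (hU.pow 2) hne).sub_const 2).add
      ((hU.pow 2).const_mul 3)
  · obtain ⟨D, B, hD, hDB⟩ := fracU_growth γ
    refine ⟨2 * D + 6, max B 1, fun τ hτ ↦ ?_⟩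
    obtain ⟨h1, h2⟩ := hDB τ ((le_max_left _ _).trans_lt hτ)
    have hτ1 : 1 ≤ τ.im := (le_max_right _ _).trans hτ.le
    set x := fracU (γ • τ)
    set E := Real.exp (D * τ.im)
    have hE : 1 ≤ E := Real.one_le_exp (by positivity)
    have h6 : (6 : ℝ) ≤ Real.exp (6 * τ.im) := by linarith [Real.add_one_le_exp (6 * τ.im)]
    calc ‖1 / x ^ 2 - 2 + 3 * x ^ 2‖ ≤ ‖1 / x ^ 2‖ + ‖(2 : ℂ)‖ + ‖3 * x ^ 2‖ :=
          (norm_add_le _ _).trans (by gcongr; exact norm_sub_le _ _)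
      _ = ‖x‖⁻¹ ^ 2 + 2 + 3 * ‖x‖ ^ 2 := by
          rw [norm_div, norm_one, norm_pow, one_div, inv_pow, norm_mul, norm_pow]; norm_num
      _ ≤ E ^ 2 + 2 * E ^ 2 + 3 * E ^ 2 := by
          have : 1 ≤ E ^ 2 := one_le_pow₀ hE
          have : 0 ≤ ‖x‖⁻¹ := by positivity
          gcongr
          linarith
      _ = E ^ 2 * 6 := by ring
      _ ≤ E ^ 2 * Real.exp (6 * τ.im) := by gcongr
      _ = Real.exp ((2 * D + 6) * τ.im) := by
          rw [← Real.exp_nat_mul, ← Real.exp_add]; congr 1; push_cast; ring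

theorem isModularFunction_fracJ_pow_add :
    IsModularFunction (CongruenceSubgroup.Gamma0 10)
      (fun τ : ℍ ↦ fracJ τ ^ 4 + 1 / fracI τ ^ 4) := by
  simp only [fracJ_pow_add]
  refine isModularFunction_of_growth ?_ (fun γ hγ τ ↦ ?_) fun γ ↦ ?_
  · have hU := differentiableOn_fracU
    have hne : ∀ n : ℕ, ∀ z ∈ {z : ℂ | 0 < z.im}, (fracU ∘ ofComplex) z ^ n ≠ 0 :=
      fun n z _ ↦ pow_ne_zero n (fracU_ne_zero _)
    exact (((differentiableOn_const 1).div (hU.pow 6) (hne 6)).sub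
      ((differentiableOn_const 2).div (hU.pow 4) (hne 4))).add
      ((differentiableOn_const 3).div (hU.pow 2) (hne 2))
  · have h := fracU_sq_smul hγ τ
    have h4 : fracU (γ • τ) ^ 4 = fracU τ ^ 4 := by
      rw [show 4 = 2 * 2 from rfl, pow_mul, h, ← pow_mul]
    have h6 : fracU (γ • τ) ^ 6 = fracU τ ^ 6 := by
      rw [show 6 = 2 * 3 from rfl, pow_mul, h, ← pow_mul]
    rw [h, h4, h6]
  · obtain ⟨D, B, hD, hDB⟩ := fracU_growth γ
    refine ⟨6 * D + 6, max B 1, fun τ hτ ↦ ?_⟩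
    obtain ⟨-, h2⟩ := hDB τ ((le_max_left _ _).trans_lt hτ)
    have hτ1 : 1 ≤ τ.im := (le_max_right _ _).trans hτ.le
    set x := fracU (γ • τ)
    set E := Real.exp (D * τ.im)
    have hE : 1 ≤ E := Real.one_le_exp (by positivity)
    have h6 : (6 : ℝ) ≤ Real.exp (6 * τ.im) := by linarith [Real.add_one_le_exp (6 * τ.im)]
    have hx : ∀ n : ℕ, n ≤ 6 → ‖x‖⁻¹ ^ n ≤ E ^ 6 := fun n hn ↦
      (pow_le_pow_left₀ (by positivity) h2 n).trans (pow_le_pow_right₀ hE hn)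
    calc ‖1 / x ^ 6 - 2 / x ^ 4 + 3 / x ^ 2‖ ≤ ‖1 / x ^ 6‖ + ‖2 / x ^ 4‖ + ‖3 / x ^ 2‖ :=
          (norm_add_le _ _).trans (by gcongr; exact norm_sub_le _ _)
      _ = ‖x‖⁻¹ ^ 6 + 2 * ‖x‖⁻¹ ^ 4 + 3 * ‖x‖⁻¹ ^ 2 := by
          simp only [norm_div, norm_one, norm_pow, Complex.norm_ofNat]
          ring
      _ ≤ E ^ 6 + 2 * E ^ 6 + 3 * E ^ 6 := by
          gcongr
          · exact hx 4 (by norm_num)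
          · exact hx 2 (by norm_num)
      _ = E ^ 6 * 6 := by ring
      _ ≤ E ^ 6 * Real.exp (6 * τ.im) := by gcongr
      _ = Real.exp ((6 * D + 6) * τ.im) := by
          rw [← Real.exp_nat_mul, ← Real.exp_add]; congr 1; push_cast; ring

theorem theorem3p6 :
    IsModularFunction (CongruenceSubgroup.Gamma0 10)
        (fun τ : ℍ ↦ fracI τ ^ 4 + 1 / fracJ τ ^ 4) ∧
      IsModularFunction (CongruenceSubgroup.Gamma0 10)
        (fun τ : ℍ ↦ fracJ τ ^ 4 + 1 / fracI τ ^ 4) ∧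
      (∀ τ : ℍ, fracI τ ^ 4 + 1 / fracJ τ ^ 4 =
        1 / fracU τ ^ 2 - 2 + 3 * fracU τ ^ 2) ∧
      (∀ τ : ℍ, fracJ τ ^ 4 + 1 / fracI τ ^ 4 =
        1 / fracU τ ^ 6 - 2 / fracU τ ^ 4 + 3 / fracU τ ^ 2) :=
  ⟨isModularFunction_fracI_pow_add, isModularFunction_fracJ_pow_add, fracI_pow_add, fracJ_pow_add⟩
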